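/- Let $\mathcal C=\langle S,s_I,\Delta,E,C,L\rangle$ be a labeled continuous-time Markov chain: $S$ is a finite set of states, $s_I\in S$ is the initial state, $\Delta(s)$ is the jump distribution on $S$ and $E(s)\ge 0$ the exit rate of $s$ (for $E(s)=0$ the chain stays in $s$ forever), and $L\colon S\to C$ is a labeling by colors. Let $\mathbb P_{\mathcal C}$ be its probability measure on timed paths $\pi=s_0\tau_0s_1\tau_1\cdots$ with $s_0=s_I$, let $\pi(t)$ be the state at time $t$, and let $\Pr_s(t)=\delta_s\,e^{(R-\mathrm{diag}(E))t}$, with $R(s,s')=\Delta(s)(s')E(s)$, be the transient distribution from $s$. Let $w\colon S\to\mathbb R_{\ge0}$ be a weight function. Let $\Omega=\langle\mathcal T_1,o_1\rangle,\dots,\langle\mathcal T_d,o_d\rangle$, $d\ge1$, be imprecisely timed evidence: $o_i\in C$, each $\mathcal T_i\subset\mathbb R_{>0}$ is a nonempty finite union of compact intervals (possibly single points), and $\max\mathcal T_i<\min\mathcal T_{i+1}$. An instance $\rho\in\Omega$ is a sequence $\langle t_1,o_1\rangle,\dots,\langle t_d,o_d\rangle$ with $t_i\in\mathcal T_i$ for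 all $i$; write $\pi\models\rho$ if $L(\pi(t_i))=o_i$ for all $i$. Put $$W(\Omega)=\sup_{\rho\in\Omega}\ \sum_{s\in S}\mathbb P_{\mathcal C}\big(\pi(t_d)=s\mid \pi\models\rho\big)\,w(s),$$ where a conditional probability given an event of probability $0$ is $0$. Let $G_\Omega$ be the union over all $\rho\in\Omega$ of the directed graphs $0\to t_1\to\cdots\to t_d\to t_\star$, where $t_\star$ is a fresh terminal node. The unfolded MDP $\mathcal M$ has the states $\langle s,t\rangle$ with $s\in S$ and $t$ a node of $G_\Omega$, and initial state $\langle s_I,0\rangle$. The actions enabled in $\langle s,t\rangle$ are the successors $t'$ of $t$ in $G_\Omega$; action $t'\ne t_\star$ leads to $\langle s',t'\rangle$ with probability $\Pr_s(t'-t)(s')$, and action $t_\star$ leads to $\langle s,t_\star\rangle$ with probability $1$. The states $\langle s,t_\star\rangle$ are absorbing. The conditioned MDP $\mathcal M_{|\Omega}$ has the same states, initial state and actions as $\mathcal M$, but in every state $\langle s,t\rangle$ with $t\in\mathcal T_i$ and $L(s)\ne o_i$ for some $i$, every enabled action leads to $\langle s_I,0\rangle$ with probability $1$. A (memoryless deterministic)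 scheduler $\sigma$, which selects an enabled action in every state that has one, is consistent if for some $\rho\in\Omega$ and all $s\in S$ one has $\sigma(\langle s,0\rangle)=t_1$, $\sigma(\langle s,t_i\rangle)=t_{i+1}$ for $1\le i<d$, and $\sigma(\langle s,t_d\rangle)=t_\star$. Write $\mathbb P^\sigma_{\mathcal M_{|\Omega}}(\lozenge q)$ for the probability that the Markov chain induced by $\sigma$ in $\mathcal M_{|\Omega}$ ever reaches the state $q$. **Theorem 2.** It holds that $$W(\Omega)=\sup_{\sigma\ \text{consistent}}\ \sum_{s\in S}\mathbb P^\sigma_{\mathcal M_{|\Omega}}\big(\lozenge\,\langle s,t_\star\rangle\big)\,w(s).$$ Moreover, if the evidence is precisely timed, i.e. every $\mathcal T_i$ is a single point, then $\mathcal M$ has finitely many states and exactly one scheduler $\sigma$; this $\sigma$ is consistent, and $W(\Omega)=\sum_{s\in S}\mathbb P^\sigma_{\mathcal M_{|\Omega}}(\lozenge\,\langle s,t_\star\rangle)\,w(s)$ is a weighted reachability in a finite discrete-time Markov chain. -/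

import Mathlib

open MeasureTheory ProbabilityTheory
open scoped NNReal ENNReal

noncomputable section

/-! ## Matrix exponentials of rate matrices -/

section ExpFacts

attribute [local instance] Matrix.linftyOpNormedRing Matrix.linftyOpNormedAlgebra

variable {S : Type*} [Fintype S] [DecidableEq S]

theorem hasSum_exp_apply (A : Matrix S S ℝ) (i j : S) :
    HasSum (fun n : ℕ => ((n.factorial : ℝ)⁻¹ • A ^ n) i j) (NormedSpace.exp A i j) := by
  have h : HasSum (fun n : ℕ => (n.factorial : ℝ)⁻¹ • A ^ n) (NormedSpace.exp A) :=
    NormedSpace.exp_series_hasSum_exp' (𝕂 := ℝ) A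
  exact Pi.hasSum.1 (Pi.hasSum.1 h i) j

theorem exp_apply_nonneg_of_nonneg (A : Matrix S S ℝ) (hA : ∀ i j, 0 ≤ A i j) (i j : S) :
    0 ≤ NormedSpace.exp A i j := by
  have hpow : ∀ (n : ℕ) (i j : S), 0 ≤ (A ^ n) i j := by
    intro n
    induction n with
    | zero =>
      intro i j
      rw [pow_zero, Matrix.one_apply]
      split_ifs <;> norm_num
    | succ n ih =>
      intro i j
      rw [pow_succ, Matrix.mul_apply]
      exact Finset.sum_nonneg fun k _ => mul_nonneg (ih i k) (hA k j)
  refine (hasSum_exp_apply A i j).nonneg fun n => ?_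
  rw [Matrix.smul_apply, smul_eq_mul]
  exact mul_nonneg (by positivity) (hpow n i j)

theorem exp_apply_nonneg_of_offDiag (A : Matrix S S ℝ) (hA : ∀ i j, i ≠ j → 0 ≤ A i j) (i j : S) :
    0 ≤ NormedSpace.exp A i j := by
  set c : ℝ := ∑ k, |A k k| with hc
  have hsplit : A = (-c) • (1 : Matrix S S ℝ) + (A + c • (1 : Matrix S S ℝ)) := by
    rw [neg_smul]; abel
  have hcomm : Commute ((-c) • (1 : Matrix S S ℝ)) (A + c • (1 : Matrix S S ℝ)) :=
    (Commute.one_left _).smul_left _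
  have h1 : NormedSpace.exp ((-c) • (1 : Matrix S S ℝ))
      = (Real.exp (-c)) • (1 : Matrix S S ℝ) := by
    rw [Matrix.smul_one_eq_diagonal, Matrix.exp_diagonal, Matrix.smul_one_eq_diagonal]
    congr 1
    funext k
    rw [Pi.coe_exp, Real.exp_eq_exp_ℝ]
  rw [hsplit, Matrix.exp_add_of_commute _ _ hcomm, h1, smul_mul_assoc, one_mul,
    Matrix.smul_apply, smul_eq_mul]
  refine mul_nonneg (Real.exp_pos _).le (exp_apply_nonneg_of_nonneg _ (fun k l => ?_) i j)
  rw [Matrix.add_apply, Matrix.smul_apply, Matrix.one_apply, smul_eq_mul]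
  by_cases h : k = l
  · subst h
    have := Finset.single_le_sum (f := fun k => |A k k|) (fun k _ => abs_nonneg _)
      (Finset.mem_univ k)
    have h2 := neg_abs_le (A k k)
    simp only [if_true, mul_one]
    linarith
  · simpa [h] using hA k l h

theorem exp_row_sum (A : Matrix S S ℝ) (hA : ∀ i, ∑ j, A i j = 0) (i : S) :
    ∑ j, NormedSpace.exp A i j = 1 := by
  have hpow : ∀ n : ℕ, ∀ i, ∑ j, (A ^ (n + 1)) i j = 0 := by
    intro n i
    simp only [pow_succ, Matrix.mul_apply]
    rw [Finset.sum_comm]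
    simp [← Finset.mul_sum, hA]
  have hs : HasSum (fun n : ℕ => ∑ j, ((n.factorial : ℝ)⁻¹ • A ^ n) i j)
      (∑ j, NormedSpace.exp A i j) :=
    hasSum_sum fun j _ => hasSum_exp_apply A i j
  refine hs.unique ?_
  have h0 : (1 : ℝ) = ∑ j, (((0 : ℕ).factorial : ℝ)⁻¹ • A ^ 0) i j := by
    simp [Matrix.one_apply]
  rw [h0]
  refine hasSum_single 0 fun n hn => ?_
  obtain ⟨m, rfl⟩ := Nat.exists_eq_succ_of_ne_zero hn
  simp only [Matrix.smul_apply, smul_eq_mul, ← Finset.mul_sum]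
  rw [hpow m i, mul_zero]

end ExpFacts

/-! ## Discrete-time Markov chains on a measurable space -/

/-- The law on `ℕ → X` (product sigma-algebra) of the time-homogeneous Markov chain with
initial distribution `μ₀` and one-step kernel `κ`. -/
def chainLaw {X : Type*} [MeasurableSpace X] (μ₀ : Measure X) (κ : Kernel X X)
    [IsMarkovKernel κ] : Measure (ℕ → X) :=
  Kernel.trajMeasure (X := fun _ : ℕ => X) μ₀ fun n =>
    κ.comap (fun h : (i : Finset.Iic n) → X => h ⟨n, Finset.mem_Iic.2 le_rfl⟩)
      (measurable_pi_apply _)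

/-- The kernel of a transition function on a discrete state space. -/
def stepKernel {X Y : Type*} [MeasurableSpace X] [DiscreteMeasurableSpace X] [MeasurableSpace Y]
    (p : X → PMF Y) : Kernel X Y where
  toFun x := (p x).toMeasure
  measurable' := .of_discrete

instance {X Y : Type*} [MeasurableSpace X] [DiscreteMeasurableSpace X] [MeasurableSpace Y]
    (p : X → PMF Y) : IsMarkovKernel (stepKernel p) :=
  ⟨fun x => inferInstanceAs (IsProbabilityMeasure (p x).toMeasure)⟩

/-! ## Continuous-time Markov chains -/

/-- A labeled CTMC with states `S` and colors `C`. -/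
structure CTMC (S C : Type*) where
  /-- initial state -/
  init : S
  /-- transition matrix -/
  Δ : S → PMF S
  /-- exit rates -/
  E : S → ℝ≥0
  /-- labeling -/
  L : S → C

namespace CTMC

variable {S C : Type*}

/-- The transition rate matrix `R(s,s') = Δ(s,s') · E(s)`. -/
def rate (𝒞 : CTMC S C) : Matrix S S ℝ :=
  Matrix.of fun s s' => (𝒞.Δ s s').toReal * (𝒞.E s : ℝ)

/-- `R - diag(E)`. -/
def generator [DecidableEq S] (𝒞 : CTMC S C) : Matrix S S ℝ :=
  𝒞.rate - Matrix.diagonal fun s => (𝒞.E s : ℝ)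

theorem generator_nonneg [DecidableEq S] (𝒞 : CTMC S C) (s s' : S) (h : s ≠ s') : 0 ≤ 𝒞.generator s s' := by
  simp only [generator, rate, Matrix.sub_apply, Matrix.of_apply, Matrix.diagonal_apply_ne _ h,
    sub_zero]
  positivity

section Transient

variable [Fintype S] [DecidableEq S]

theorem generator_row_sum (𝒞 : CTMC S C) (s : S) : ∑ s', 𝒞.generator s s' = 0 := by
  have h : ∑ s', (𝒞.Δ s s').toReal = 1 := by
    rw [← ENNReal.toReal_sum fun s' _ => PMF.apply_ne_top _ _, ← tsum_fintype (L := .unconditional _),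
      PMF.tsum_coe, ENNReal.toReal_one]
  simp [generator, rate, Matrix.sub_apply, Finset.sum_sub_distrib, ← Finset.sum_mul, h,
    Matrix.diagonal_apply]

/-- The transient probability distribution `Pr_s(t) = δ_s · exp((R - diag E) t)`. -/
def transient (𝒞 : CTMC S C) (s : S) (t : ℝ≥0) : PMF S :=
  PMF.ofFintype
    (fun s' => ENNReal.ofReal (NormedSpace.exp ((t : ℝ) • 𝒞.generator) s s')) (by
      rw [← ENNReal.ofReal_sum_of_nonneg, exp_row_sum, ENNReal.ofReal_one]
      · intro i
        simp [← Finset.mul_sum, 𝒞.generator_row_sum i]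
      · intro s' _
        refine exp_apply_nonneg_of_offDiag _ (fun i j hij => ?_) _ _
        exact mul_nonneg t.2 (𝒞.generator_nonneg i j hij))

end Transient

/-- The law of the residence time in `s`: exponential with rate `E(s)`, and infinite if
`E(s) = 0`. -/
def residenceLaw (𝒞 : CTMC S C) (s : S) : Measure ℝ≥0∞ :=
  if 𝒞.E s = 0 then Measure.dirac ∞
  else (expMeasure (𝒞.E s : ℝ)).map ENNReal.ofReal

instance (𝒞 : CTMC S C) (s : S) : IsProbabilityMeasure (𝒞.residenceLaw s) := by
  unfold residenceLaw
  split_ifs with h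
  · infer_instance
  · have : IsProbabilityMeasure (expMeasure (𝒞.E s : ℝ)) :=
      isProbabilityMeasure_expMeasure (by exact_mod_cast pos_iff_ne_zero.2 h)
    exact Measure.isProbabilityMeasure_map ENNReal.measurable_ofReal.aemeasurable

section Paths

variable [MeasurableSpace S] [DiscreteMeasurableSpace S]

/-- The law of `(s, τ)`, where `τ` is the residence time in the state `s` just entered. -/
def enterKernel (𝒞 : CTMC S C) : Kernel S (S × ℝ≥0∞) where
  toFun s := (Measure.dirac s).prod (𝒞.residenceLaw s)
  measurable' := .of_discrete

instance (𝒞 : CTMC S C) : IsMarkovKernel 𝒞.enterKernel :=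
  ⟨fun s => inferInstanceAs
    (IsProbabilityMeasure ((Measure.dirac s).prod (𝒞.residenceLaw s)))⟩

/-- One step of a timed path: from `(s, τ)`, the next state is drawn from `Δ(s)`, and then its
residence time is drawn. -/
def jumpKernel (𝒞 : CTMC S C) : Kernel (S × ℝ≥0∞) (S × ℝ≥0∞) :=
  (𝒞.enterKernel ∘ₖ stepKernel 𝒞.Δ).comap Prod.fst measurable_fst

instance (𝒞 : CTMC S C) : IsMarkovKernel 𝒞.jumpKernel := by
  unfold jumpKernel; infer_instance

/-- The probability measure of the CTMC on timed paths `s₀ τ₀ s₁ τ₁ ⋯`, started in the initial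
state. -/
def pathMeasure (𝒞 : CTMC S C) : Measure (ℕ → S × ℝ≥0∞) :=
  chainLaw (𝒞.enterKernel 𝒞.init) 𝒞.jumpKernel

end Paths

end CTMC

/-- `InStateAt π t s` means `π(t) = s`: the timed path `π = s₀ τ₀ s₁ τ₁ ⋯` is in `s` at time
`t`, i.e. `s = s_k` for the `k` with `τ₀ + ⋯ + τ_{k-1} ≤ t < τ₀ + ⋯ + τ_k`. -/
def InStateAt {S : Type*} (π : ℕ → S × ℝ≥0∞) (t : ℝ≥0) (s : S) : Prop :=
  ∃ k : ℕ, (π k).1 = s ∧ ∑ i ∈ Finset.range k, (π i).2 ≤ (t : ℝ≥0∞) ∧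
    (t : ℝ≥0∞) < ∑ i ∈ Finset.range (k + 1), (π i).2

/-! ## Evidence -/

/-- Precisely timed evidence `⟨t₁,o₁⟩,…,⟨t_d,o_d⟩` (indexed from `0`). -/
structure Evidence (C : Type*) (d : ℕ) where
  time : Fin d → ℝ≥0
  label : Fin d → C
  time_pos : ∀ i, 0 < time i
  time_strictMono : StrictMono time

/-- Imprecisely timed evidence `⟨𝒯₁,o₁⟩,…,⟨𝒯_d,o_d⟩`, where `𝒯ᵢ` is a nonempty finite union of
closed intervals `[a,b]`, `0 < a ≤ b`, given by their pairs of endpoints. -/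
structure ImpreciseEvidence (C : Type*) (d : ℕ) where
  intervals : Fin d → Finset (ℝ≥0 × ℝ≥0)
  label : Fin d → C
  intervals_nonempty : ∀ i, (intervals i).Nonempty
  intervals_pos : ∀ i, ∀ I ∈ intervals i, 0 < I.1
  intervals_le : ∀ i, ∀ I ∈ intervals i, I.1 ≤ I.2
  /-- every time in `𝒯ᵢ` is smaller than every time in `𝒯ᵢ₊₁` -/
  ordered : ∀ i j : Fin d, (i : ℕ) + 1 = j → ∀ I ∈ intervals i, ∀ J ∈ intervals j, I.2 < J.1

/-- The path `π` is consistent with the evidence `ρ` (written `π ⊨ ρ`). -/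
def PathConsistent {S C : Type*} {d : ℕ} (𝒞 : CTMC S C) (ρ : Evidence C d)
    (π : ℕ → S × ℝ≥0∞) : Prop :=
  ∀ i, ∃ s, InStateAt π (ρ.time i) s ∧ 𝒞.L s = ρ.label i

namespace ImpreciseEvidence

variable {C : Type*} {d : ℕ}

/-- The set of times `𝒯ᵢ`. -/
def timing (Ω : ImpreciseEvidence C d) (i : Fin d) : Set ℝ≥0 :=
  ⋃ I ∈ Ω.intervals i, Set.Icc I.1 I.2

/-- The set of instances `ρ ∈ Ω`. -/
def instances (Ω : ImpreciseEvidence C d) : Set (Evidence C d) :=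
  {ρ | (∀ i, ρ.time i ∈ Ω.timing i) ∧ ρ.label = Ω.label}

theorem instances_nonempty (Ω : ImpreciseEvidence C d) : Ω.instances.Nonempty := by
  choose I hI using Ω.intervals_nonempty
  have hmono : StrictMono fun i => (I i).1 := by
    cases d with
    | zero => exact fun i => i.elim0
    | succ n =>
      refine Fin.strictMono_iff_lt_succ.2 fun i => ?_
      exact lt_of_le_of_lt (Ω.intervals_le _ _ (hI _))
        (Ω.ordered i.castSucc i.succ (by simp) _ (hI _) _ (hI _))
  refine ⟨⟨fun i => (I i).1, Ω.label, fun i => Ω.intervals_pos i _ (hI i), hmono⟩, ?_, rfl⟩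
  intro i
  exact Set.mem_biUnion (hI i) ⟨le_rfl, Ω.intervals_le i _ (hI i)⟩

end ImpreciseEvidence

/-- The weighted conditional reachability probability
`W(Ω) = sup_{ρ ∈ Ω} ∑_s ℙ(π(t_d) = s ∣ π ⊨ ρ) · w(s)`, where conditioning on an event of
probability zero gives `0`. -/
def weightedCondReach {S C : Type*} [Fintype S] [MeasurableSpace S] [DiscreteMeasurableSpace S]
    {n : ℕ} (𝒞 : CTMC S C) (w : S → ℝ≥0) (Ω : ImpreciseEvidence C (n + 1)) : ℝ≥0∞ :=
  ⨆ ρ ∈ Ω.instances, ∑ s,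
    ProbabilityTheory.cond 𝒞.pathMeasure {π | PathConsistent 𝒞 ρ π}
      {π | InStateAt π (ρ.time (Fin.last n)) s} * (w s : ℝ≥0∞)

/-! ## Evidence graphs -/

/-- A directed graph on points in time, with `∞` in the role of the terminal node `t⋆`. -/
structure EvidenceGraph where
  nodes : Set ℝ≥0∞
  edge : ℝ≥0∞ → ℝ≥0∞ → Prop
  edge_mem : ∀ {t t'}, edge t t' → t ∈ nodes ∧ t' ∈ nodes
  edge_lt : ∀ {t t'}, edge t t' → t < t'
  zero_mem : 0 ∈ nodes

/-- The graph `0 → t₁ → ⋯ → t_d → t⋆` of precise evidence. -/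
def Evidence.graph {C : Type*} {n : ℕ} (ρ : Evidence C (n + 1)) : EvidenceGraph where
  nodes := {0, ∞} ∪ Set.range fun i => (ρ.time i : ℝ≥0∞)
  edge t t' :=
    (t = 0 ∧ t' = ρ.time 0) ∨
    (∃ i : Fin n, t = ρ.time i.castSucc ∧ t' = ρ.time i.succ) ∨
    (t = ρ.time (Fin.last n) ∧ t' = ∞)
  edge_mem := by
    rintro t t' (⟨rfl, rfl⟩ | ⟨i, rfl, rfl⟩ | ⟨rfl, rfl⟩) <;> simp
  edge_lt := by
    rintro t t' (⟨rfl, rfl⟩ | ⟨i, rfl, rfl⟩ | ⟨rfl, rfl⟩)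
    · exact_mod_cast ρ.time_pos 0
    · exact_mod_cast ρ.time_strictMono i.castSucc_lt_succ
    · exact ENNReal.coe_lt_top
  zero_mem := by simp

/-- The graph of imprecise evidence: the union of the graphs of its instances. -/
def ImpreciseEvidence.graph {C : Type*} {n : ℕ} (Ω : ImpreciseEvidence C (n + 1)) :
    EvidenceGraph where
  nodes := ⋃ ρ ∈ Ω.instances, ρ.graph.nodes
  edge t t' := ∃ ρ ∈ Ω.instances, ρ.graph.edge t t'
  edge_mem := by
    rintro t t' ⟨ρ, hρ, h⟩
    exact ⟨Set.mem_biUnion hρ (ρ.graph.edge_mem h).1, Set.mem_biUnion hρ (ρ.graph.edge_mem h).2⟩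
  edge_lt := by
    rintro t t' ⟨ρ, -, h⟩
    exact ρ.graph.edge_lt h
  zero_mem := by
    obtain ⟨ρ, hρ⟩ := Ω.instances_nonempty
    exact Set.mem_biUnion hρ ρ.graph.zero_mem

/-! ## Markov decision processes -/

/-- An MDP with states `Q` and actions `A`; `enabled q` is the set of actions enabled in `q`, and
the (partial) transition function is given at the enabled actions. -/
structure MDP (Q A : Type*) where
  init : Q
  enabled : Q → Set A
  P : (q : Q) → enabled q → PMF Q

namespace MDP

variable {Q A : Type*}

/-- A memoryless scheduler picks an enabled action in every state that has one. -/
abbrev Scheduler (M : MDP Q A) : Type _ :=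
  (q : {q : Q // (M.enabled q).Nonempty}) → M.enabled q.1

/-- `σ(q) = a`. -/
def Chooses (M : MDP Q A) (σ : M.Scheduler) (q : Q) (a : A) : Prop :=
  ∃ h : (M.enabled q).Nonempty, (σ ⟨q, h⟩ : A) = a

open Classical in
/-- The transition function of the Markov chain induced by a scheduler; states without enabled
actions are absorbing. -/
def step (M : MDP Q A) (σ : M.Scheduler) (q : Q) : PMF Q :=
  if h : (M.enabled q).Nonempty then M.P q (σ ⟨q, h⟩) else PMF.pure q

/-- The probability measure on infinite paths of the Markov chain induced by a scheduler. -/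
def pathMeasure [MeasurableSpace Q] [DiscreteMeasurableSpace Q] (M : MDP Q A)
    (σ : M.Scheduler) : Measure (ℕ → Q) :=
  chainLaw (Measure.dirac M.init) (stepKernel (M.step σ))

/-- The probability `ℙ^σ(◇ q)` of eventually reaching the state `q`. -/
def reach [MeasurableSpace Q] [DiscreteMeasurableSpace Q] (M : MDP Q A) (σ : M.Scheduler)
    (q : Q) : ℝ≥0∞ :=
  M.pathMeasure σ {ξ | ∃ n, ξ n = q}

open Classical in
/-- The MDP in which every transition from a state in `R` goes to the initial state. -/
abbrev reset (M : MDP Q A) (R : Set Q) : MDP Q A where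
  init := M.init
  enabled := M.enabled
  P q a := if q ∈ R then PMF.pure M.init else M.P q a

end MDP

/-! ## The unfolded and the conditioned MDP -/

/-- A state `⟨s,t⟩` of the unfolded MDP. -/
@[ext]
structure UnfoldedState (S : Type*) (G : EvidenceGraph) where
  state : S
  time : G.nodes

instance {S : Type*} {G : EvidenceGraph} : MeasurableSpace (UnfoldedState S G) := ⊤

instance {S : Type*} {G : EvidenceGraph} : DiscreteMeasurableSpace (UnfoldedState S G) :=
  ⟨fun _ => trivial⟩

open Classical in
/-- The unfolded MDP `Unfold(𝒞, G)`. -/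
def unfoldedMDP {S C : Type*} [Fintype S] [DecidableEq S] (𝒞 : CTMC S C) (G : EvidenceGraph) :
    MDP (UnfoldedState S G) G.nodes where
  init := ⟨𝒞.init, ⟨0, G.zero_mem⟩⟩
  enabled q := {t' | G.edge q.time t'}
  P q t' :=
    if (t' : G.nodes) = (∞ : ℝ≥0∞) then PMF.pure ⟨q.state, t'⟩
    else (𝒞.transient q.state (((t' : G.nodes) : ℝ≥0∞) - q.time).toNNReal).map
      fun s' => ⟨s', t'⟩

/-- The states `⟨s,t⟩` with `L(s) ≠ Ω(t)`; only times `t` in some `𝒯ᵢ` carry a label `Ω(t)`. -/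
def resetStates {S C : Type*} {n : ℕ} (𝒞 : CTMC S C) (Ω : ImpreciseEvidence C (n + 1)) :
    Set (UnfoldedState S Ω.graph) :=
  {q | ∃ i, ∃ t ∈ Ω.timing i, (q.time : ℝ≥0∞) = (t : ℝ≥0∞) ∧ 𝒞.L q.state ≠ Ω.label i}

/-- The conditioned MDP `M|Ω` of `M = Unfold(𝒞, G_Ω)`. -/
abbrev conditionedMDP {S C : Type*} [Fintype S] [DecidableEq S] {n : ℕ} (𝒞 : CTMC S C)
    (Ω : ImpreciseEvidence C (n + 1)) : MDP (UnfoldedState S Ω.graph) Ω.graph.nodes :=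
  (unfoldedMDP 𝒞 Ω.graph).reset (resetStates 𝒞 Ω)

/-- The scheduler `σ` is consistent with the evidence `ρ` (written `σ ∼ ρ`). -/
def SchedulerConsistent {S C : Type*} [Fintype S] [DecidableEq S] {n : ℕ} {𝒞 : CTMC S C}
    {G : EvidenceGraph} (σ : (unfoldedMDP 𝒞 G).Scheduler) (ρ : Evidence C (n + 1)) : Prop :=
  ∀ (q : UnfoldedState S G) (t' : G.nodes),
    ((q.time : ℝ≥0∞) = 0 → (t' : ℝ≥0∞) = ρ.time 0 → (unfoldedMDP 𝒞 G).Chooses σ q t') ∧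
    (∀ i : Fin n, (q.time : ℝ≥0∞) = ρ.time i.castSucc → (t' : ℝ≥0∞) = ρ.time i.succ →
      (unfoldedMDP 𝒞 G).Chooses σ q t') ∧
    ((q.time : ℝ≥0∞) = ρ.time (Fin.last n) → (t' : ℝ≥0∞) = ∞ → (unfoldedMDP 𝒞 G).Chooses σ q t')

/-- The set of consistent schedulers of `Unfold(𝒞, G_Ω)`: those consistent with some instance
of `Ω`. -/
def consistentSchedulers {S C : Type*} [Fintype S] [DecidableEq S] {n : ℕ} (𝒞 : CTMC S C)
    (Ω : ImpreciseEvidence C (n + 1)) : Set (unfoldedMDP 𝒞 Ω.graph).Scheduler :=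
  {σ | ∃ ρ ∈ Ω.instances, SchedulerConsistent σ ρ}

/-- The terminal state `⟨s,t⋆⟩`. -/
def terminal {S C : Type*} {n : ℕ} (Ω : ImpreciseEvidence C (n + 1)) (s : S) :
    UnfoldedState S Ω.graph :=
  ⟨s, ⟨∞, by
    obtain ⟨ρ, hρ⟩ := Ω.instances_nonempty
    exact Set.mem_biUnion hρ (by simp [Evidence.graph])⟩⟩

/-- The weighted reachability `∑_s ℙ^σ_{M|Ω}(◇ ⟨s,t⋆⟩) · w(s)` in the conditioned MDP. -/
def weightedReach {S C : Type*} [Fintype S] [DecidableEq S] {n : ℕ} (𝒞 : CTMC S C)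
    (w : S → ℝ≥0) (Ω : ImpreciseEvidence C (n + 1)) (σ : (unfoldedMDP 𝒞 Ω.graph).Scheduler) : ℝ≥0∞ :=
  ∑ s, (conditionedMDP 𝒞 Ω).reach σ (terminal Ω s) * (w s : ℝ≥0∞)

end

/-!
Both sides reduce to the same numbers. Write `g s` for the probability that a path of the chain
satisfies a fixed instance `ρ` of the evidence and is in `s` at the last time, and `G` for the sum
of all `g s`, the probability of the evidence. Let `V` be the vector of values obtained by backward
recursion along `ρ` from the transient distributions (`evidenceValue`, `evidenceMass`).

*The chain.* `g s` is computed by `V`. This is the Markov property of the state process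
(`CTMC.pathMeasureFrom_eq_sum_transient`), which is not built into the definition of the path
measure by jumps and residence times. Conditioning on the first jump, and using that exponential
residence times are memoryless, the probability of an event about the states from time `t` on
satisfies a renewal equation in `t`. By Kolmogorov's backward equation, so does the
expression given by the transient distribution `exp ((R - diag E) t)`. The renewal equation has at
most one bounded solution (`CTMC.renewal_le`): substituting it into itself contracts differences by
the probability, bounded away from `1` on a bounded time interval, of a jump. Hence the conditional
probability is `G⁻¹ * g s`.

*The MDP.* Under a scheduler consistent with `ρ`, one pass through the conditioned MDP ends in
`⟨s,t⋆⟩` with probability `g s`, and restarts with probability `1 - G`. So the probability `x` of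
ever reaching `⟨s,t⋆⟩` satisfies `G * x = g s`. If `G = 0`, this equation is void; but then the
probability of reaching `⟨s,t⋆⟩` within a bounded number of steps vanishes by induction on that
number. In both cases `x = G⁻¹ * g s` (`reach_terminal`).

Every instance has a consistent scheduler, as its graph gives each node at most one successor; so
the two suprema agree. If the evidence is precisely timed, there is one instance, and the scheduler
has no choice.
-/

/-! ### First-step analysis of discrete-time Markov chains -/

section Chain

variable {X : Type*}

/-- The path that starts in `x` and continues with `ω`. -/
def pathCons (x : X) (ω : ℕ → X) : ℕ → X
  | 0 => x
  | k + 1 => ω k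

@[simp] theorem pathCons_zero (x : X) (ω : ℕ → X) : pathCons x ω 0 = x := rfl

@[simp] theorem pathCons_succ (x : X) (ω : ℕ → X) (k : ℕ) : pathCons x ω (k + 1) = ω k := rfl

/-- The path that follows `ξ` up to time `n` and stays there forever. -/
def stopPath (n : ℕ) (ξ : ℕ → X) : ℕ → X := fun i => ξ (min i n)

/-- The path that follows `ξ` up to time `n` and is `y` afterwards. -/
def thenPath (n : ℕ) (ξ : ℕ → X) (y : X) : ℕ → X := fun i => if i ≤ n then ξ i else y

theorem stopPath_succ (n : ℕ) (ξ : ℕ → X) :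
    stopPath (n + 1) ξ = thenPath n (stopPath n ξ) (ξ (n + 1)) := by
  funext i
  by_cases h : i ≤ n
  · simp [stopPath, thenPath, h, min_eq_left (h.trans n.le_succ)]
  · simp [stopPath, thenPath, h, min_eq_right (Nat.succ_le_of_lt (not_le.1 h))]

theorem stopPath_pathCons (n : ℕ) (x : X) (ω : ℕ → X) :
    stopPath (n + 1) (pathCons x ω) = pathCons x (stopPath n ω) := by
  funext i
  cases i with
  | zero => simp [stopPath]
  | succ i => simp [stopPath, Nat.succ_min_succ]

variable [MeasurableSpace X]

theorem measurable_pathCons : Measurable fun p : X × (ℕ → X) => pathCons p.1 p.2 := by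
  refine measurable_pi_iff.2 fun k => ?_
  cases k with
  | zero => exact measurable_fst
  | succ k => exact (measurable_pi_apply k).comp measurable_snd

theorem measurable_stopPath (n : ℕ) : Measurable (stopPath (X := X) n) :=
  measurable_pi_iff.2 fun _ => measurable_pi_apply _

theorem measurable_thenPath (n : ℕ) :
    Measurable fun p : (ℕ → X) × X => thenPath n p.1 p.2 := by
  refine measurable_pi_iff.2 fun i => ?_
  by_cases h : i ≤ n
  · simp only [thenPath, h, if_true]
    exact (measurable_pi_apply i).comp measurable_fst
  · simp only [thenPath, h, if_false]
    exact measurable_snd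

/-- Two finite measures on paths agree if they give the same law to every stopped path. -/
theorem measure_ext_of_stopPath {P Q : Measure (ℕ → X)} [IsFiniteMeasure P]
    (h : ∀ n (F : (ℕ → X) → ℝ≥0∞), Measurable F →
      ∫⁻ ξ, F (stopPath n ξ) ∂P = ∫⁻ ξ, F (stopPath n ξ) ∂Q) : P = Q := by
  have key : ∀ I : Finset ℕ, P.map I.restrict = Q.map I.restrict := by
    intro I
    have hres : (I.restrict : (ℕ → X) → (i : I) → X) = I.restrict ∘ stopPath (I.sup id) := by
      funext ξ i
      exact congrArg ξ (min_eq_left (Finset.le_sup (f := id) i.2)).symm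
    ext s hs
    have hm : MeasurableSet (I.restrict ⁻¹' s : Set (ℕ → X)) := Finset.measurable_restrict I hs
    have := h (I.sup id) ((I.restrict ⁻¹' s).indicator 1) (measurable_one.indicator hm)
    rw [Measure.map_apply (Finset.measurable_restrict I) hs,
      Measure.map_apply (Finset.measurable_restrict I) hs, hres, Set.preimage_comp,
      ← lintegral_indicator_one (measurable_stopPath _ hm),
      ← lintegral_indicator_one (measurable_stopPath _ hm)]
    exact this
  have hP : IsProjectiveLimit P fun I => P.map I.restrict := fun I => rfl
  have hQ : IsProjectiveLimit Q fun I => P.map I.restrict := fun I => (key I).symm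
  have : ∀ I : Finset ℕ, IsFiniteMeasure ((fun I : Finset ℕ => P.map I.restrict) I) :=
    fun I => inferInstanceAs (IsFiniteMeasure (P.map I.restrict))
  exact hP.unique hQ

variable (κ : Kernel X X) [IsMarkovKernel κ]

/-- The law of the Markov chain with one-step kernel `κ` as a function of its starting point. -/
noncomputable def chainKernel : Kernel X (ℕ → X) :=
  (Kernel.traj (X := fun _ : ℕ => X) (fun n =>
    κ.comap (fun h : (i : Finset.Iic n) → X => h ⟨n, Finset.mem_Iic.2 le_rfl⟩)
      (measurable_pi_apply _)) 0).comap (MeasurableEquiv.piUnique fun _ : Finset.Iic 0 => X).symm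
      (MeasurableEquiv.measurable _)

instance : IsMarkovKernel (chainKernel κ) := by unfold chainKernel; infer_instance

theorem chainLaw_eq_bind (μ₀ : Measure X) : chainLaw μ₀ κ = μ₀.bind (chainKernel κ) := by
  unfold chainLaw Kernel.trajMeasure chainKernel
  ext s hs
  rw [Measure.bind_apply hs (Kernel.aemeasurable _), Measure.bind_apply hs (Kernel.aemeasurable _),
    lintegral_map (Kernel.measurable_coe _ hs) (MeasurableEquiv.measurable _)]
  rfl

theorem lintegral_chainLaw (μ₀ : Measure X) {f : (ℕ → X) → ℝ≥0∞} (hf : Measurable f) :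
    ∫⁻ ξ, f ξ ∂chainLaw μ₀ κ = ∫⁻ x, ∫⁻ ξ, f ξ ∂chainKernel κ x ∂μ₀ := by
  rw [chainLaw_eq_bind, Measure.lintegral_bind (Kernel.aemeasurable _) hf.aemeasurable]

theorem chainLaw_dirac (x : X) : chainLaw (Measure.dirac x) κ = chainKernel κ x := by
  rw [chainLaw_eq_bind, Measure.dirac_bind (Kernel.measurable _)]

theorem chainKernel_map_zero (x : X) :
    (chainKernel κ x).map (fun ξ => ξ 0) = Measure.dirac x := by
  have hf : (fun ξ : ℕ → X => ξ 0) = (fun h : (i : Finset.Iic 0) → X =>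
      h ⟨0, Finset.mem_Iic.2 le_rfl⟩) ∘ Preorder.frestrictLe 0 := rfl
  have hm : Measurable fun h : (i : Finset.Iic 0) → X => h ⟨0, Finset.mem_Iic.2 le_rfl⟩ :=
    measurable_pi_apply _
  rw [hf, chainKernel, Kernel.comap_apply]
  refine (Measure.map_map hm (Preorder.measurable_frestrictLe (X := fun _ : ℕ => X) 0)).symm.trans ?_
  rw [Kernel.traj_map_frestrictLe_apply, Kernel.partialTraj_self, Kernel.id_apply]
  exact Measure.map_dirac' hm _

/-- The Markov property at time `n`: given the past, the next state is drawn from `κ`. -/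
theorem lintegral_chainKernel_succ (x : X) (n : ℕ) {F : (ℕ → X) → X → ℝ≥0∞}
    (hF : Measurable (Function.uncurry F)) :
    ∫⁻ ξ, F (stopPath n ξ) (ξ (n + 1)) ∂chainKernel κ x =
      ∫⁻ ξ, ∫⁻ y, F (stopPath n ξ) y ∂κ (ξ n) ∂chainKernel κ x := by
  have h := Kernel.map_frestrictLe_trajMeasure_compProd_eq_map_trajMeasure
    (X := fun _ : ℕ => X) (μ₀ := Measure.dirac x) (κ := fun n =>
      κ.comap (fun h : (i : Finset.Iic n) → X => h ⟨n, Finset.mem_Iic.2 le_rfl⟩)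
      (measurable_pi_apply _)) (a := n)
  change (chainLaw (Measure.dirac x) κ).map (Preorder.frestrictLe n) ⊗ₘ _ =
    (chainLaw (Measure.dirac x) κ).map _ at h
  rw [chainLaw_dirac] at h
  -- the history up to time `n` determines the path stopped at time `n`
  let e : ((i : Finset.Iic n) → X) → ℕ → X := fun h i => h ⟨min i n, by simp⟩
  have he : Measurable e := measurable_pi_iff.2 fun _ => measurable_pi_apply _
  have hG : Measurable fun p : ((i : Finset.Iic n) → X) × X => F (e p.1) p.2 :=
    hF.comp (((he.comp measurable_fst)).prodMk measurable_snd)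
  have h2 := congrArg (fun μ => ∫⁻ p, F (e p.1) p.2 ∂μ) h
  rw [Measure.lintegral_compProd hG, lintegral_map hG (by fun_prop),
    lintegral_map hG.lintegral_kernel_prod_right' (by fun_prop)] at h2
  exact h2.symm

/-- First-step decomposition: the chain started in `x` moves to `y` drawn from `κ x`, from where it
continues like the chain started in `y`. -/
theorem chainKernel_apply_eq (x : X) :
    chainKernel κ x = ((κ x).bind (chainKernel κ)).map (pathCons x) := by
  have hc : Measurable (pathCons (X := X) x) :=
    measurable_pathCons.comp (measurable_const.prodMk measurable_id)
  have hB : ∀ F : (ℕ → X) → ℝ≥0∞, Measurable F →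
      ∫⁻ ξ, F ξ ∂((κ x).bind (chainKernel κ)).map (pathCons x) =
        ∫⁻ y, ∫⁻ ω, F (pathCons x ω) ∂chainKernel κ y ∂κ x := fun F hF => by
    rw [lintegral_map hF hc]
    exact Measure.lintegral_bind (Kernel.aemeasurable _) (hF.comp hc).aemeasurable
  have h0 : ∀ (y : X) (F : X → ℝ≥0∞), Measurable F → ∫⁻ ξ, F (ξ 0) ∂chainKernel κ y = F y := by
    intro y F hF
    rw [← lintegral_map (μ := chainKernel κ y) hF (measurable_pi_apply 0), chainKernel_map_zero,
      lintegral_dirac' _ hF]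
  refine measure_ext_of_stopPath fun n => ?_
  induction n with
  | zero =>
    intro F hF
    rw [hB (fun ξ => F (stopPath 0 ξ)) (hF.comp (measurable_stopPath 0))]
    have : ∀ ξ : ℕ → X, stopPath 0 ξ = fun _ => ξ 0 := fun ξ => by funext i; simp [stopPath]
    simp only [this, pathCons_zero, lintegral_const, measure_univ, mul_one]
    exact h0 x (fun y => F fun _ => y) (hF.comp (measurable_pi_iff.2 fun _ => measurable_id))
  | succ n ih =>
    intro F hF
    have hFt : Measurable (Function.uncurry fun ξ y => F (thenPath n ξ y)) :=
      hF.comp (measurable_thenPath n)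
    have hG : Measurable fun ξ : ℕ → X => ∫⁻ y, F (thenPath n ξ y) ∂κ (ξ n) := by
      have := hFt.lintegral_kernel_prod_right' (κ := κ.comap (fun ξ : ℕ → X => ξ n)
        (measurable_pi_apply n))
      exact this
    have hl : ∫⁻ ξ, F (stopPath (n + 1) ξ) ∂chainKernel κ x =
        ∫⁻ ξ, ∫⁻ y, F (thenPath n (stopPath n ξ) y) ∂κ (stopPath n ξ n) ∂chainKernel κ x := by
      simp only [stopPath_succ]
      rw [lintegral_chainKernel_succ κ x n hFt]
      simp [stopPath]
    rw [hl, ih _ hG, hB (fun ξ => ∫⁻ y, F (thenPath n (stopPath n ξ) y) ∂κ (stopPath n ξ n))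
      (hG.comp (measurable_stopPath n)), hB (fun ξ => F (stopPath (n + 1) ξ)) (hF.comp (measurable_stopPath (n + 1)))]
    cases n with
    | zero =>
      have h1 : ∀ ω : ℕ → X, stopPath 1 (pathCons x ω) = thenPath 0 (fun _ => x) (ω 0) := by
        intro ω
        funext i
        cases i with
        | zero => simp [stopPath, thenPath]
        | succ i => simp [stopPath, thenPath]
      have h2 : ∀ ω : ℕ → X, stopPath 0 (pathCons x ω) = fun _ => x := by
        intro ω; funext i; simp [stopPath]
      have hm : Measurable fun y => F (thenPath 0 (fun _ => x) y) :=
        hFt.comp (measurable_const.prodMk measurable_id)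
      simp only [zero_add, h1, h2, lintegral_const, measure_univ, mul_one]
      exact (lintegral_congr fun y => h0 y _ hm).symm
    | succ m =>
      refine lintegral_congr fun y => ?_
      have h1 : ∀ (ω : ℕ → X) (z : X), thenPath (m + 1) (pathCons x ω) z =
          pathCons x (thenPath m ω z) := by
        intro ω z
        funext i
        cases i with
        | zero => simp [thenPath]
        | succ i => simp [thenPath]
      have hm : Measurable (Function.uncurry fun (ω : ℕ → X) z => F (pathCons x (thenPath m ω z))) :=
        (hF.comp hc).comp (measurable_thenPath m)
      have := lintegral_chainKernel_succ κ y m hm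
      simp only [stopPath_pathCons, h1, pathCons_succ]
      simp only [stopPath_succ m]
      rw [this]
      simp [stopPath]

theorem lintegral_chainKernel (x : X) {f : (ℕ → X) → ℝ≥0∞} (hf : Measurable f) :
    ∫⁻ ξ, f ξ ∂chainKernel κ x = ∫⁻ y, ∫⁻ ω, f (pathCons x ω) ∂chainKernel κ y ∂κ x := by
  have hc : Measurable (pathCons (X := X) x) :=
    measurable_pathCons.comp (measurable_const.prodMk measurable_id)
  conv_lhs => rw [chainKernel_apply_eq]
  rw [lintegral_map hf hc]
  exact Measure.lintegral_bind (Kernel.aemeasurable _) (hf.comp hc).aemeasurable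

end Chain

/-! ### Hitting probabilities of discrete Markov chains -/

section Hitting

variable {X : Type*} [MeasurableSpace X] [DiscreteMeasurableSpace X] (p : X → PMF X)

/-- The probability that the Markov chain with transition function `p`, started in `x`, ever
visits `y`. -/
noncomputable def hitProb (x y : X) : ℝ≥0∞ :=
  chainKernel (stepKernel p) x {ξ | ∃ j, ξ j = y}

/-- The probability that the Markov chain with transition function `p`, started in `x`, visits `y`
before time `k`. -/
noncomputable def hitProbBefore (k : ℕ) (x y : X) : ℝ≥0∞ :=
  chainKernel (stepKernel p) x {ξ | ∃ j < k, ξ j = y}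

theorem measurableSet_visit (y : X) : MeasurableSet {ξ : ℕ → X | ∃ j, ξ j = y} := by
  have : {ξ : ℕ → X | ∃ j, ξ j = y} = ⋃ j, (fun ξ : ℕ → X => ξ j) ⁻¹' {y} := by
    ext; simp
  rw [this]
  exact .iUnion fun j => measurable_pi_apply j (measurableSet_singleton y)

theorem measurableSet_visitBefore (k : ℕ) (y : X) :
    MeasurableSet {ξ : ℕ → X | ∃ j < k, ξ j = y} := by
  have : {ξ : ℕ → X | ∃ j < k, ξ j = y} = ⋃ j, ⋃ _ : j < k, (fun ξ : ℕ → X => ξ j) ⁻¹' {y} := by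
    ext; simp
  rw [this]
  exact .iUnion fun j => .iUnion fun _ => measurable_pi_apply j (measurableSet_singleton y)

theorem chainKernel_stepKernel_apply (x : X) {A : Set (ℕ → X)} (hA : MeasurableSet A) :
    chainKernel (stepKernel p) x A =
      ∫⁻ y, chainKernel (stepKernel p) y (pathCons x ⁻¹' A) ∂(p x).toMeasure := by
  have hc : Measurable (pathCons (X := X) x) :=
    measurable_pathCons.comp (measurable_const.prodMk measurable_id)
  rw [← lintegral_indicator_one hA, lintegral_chainKernel _ _ (measurable_one.indicator hA)]
  refine lintegral_congr fun y => ?_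
  rw [← lintegral_indicator_one (hc hA)]
  rfl

theorem hitProb_self (x : X) : hitProb p x x = 1 := by
  have : pathCons x ⁻¹' {ξ : ℕ → X | ∃ j, ξ j = x} = Set.univ :=
    Set.eq_univ_of_forall fun ω => ⟨0, rfl⟩
  rw [hitProb, chainKernel_stepKernel_apply p x (measurableSet_visit x), this]
  simp

theorem hitProb_le_one (x y : X) : hitProb p x y ≤ 1 := prob_le_one

theorem hitProb_of_ne {x y : X} (h : x ≠ y) :
    hitProb p x y = ∫⁻ z, hitProb p z y ∂(p x).toMeasure := by
  have : pathCons x ⁻¹' {ξ : ℕ → X | ∃ j, ξ j = y} = {ξ : ℕ → X | ∃ j, ξ j = y} := by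
    ext ω
    constructor
    · rintro ⟨_ | j, hj⟩
      · exact absurd hj h
      · exact ⟨j, hj⟩
    · rintro ⟨j, hj⟩
      exact ⟨j + 1, hj⟩
  rw [hitProb, chainKernel_stepKernel_apply p x (measurableSet_visit y), this]
  rfl

@[simp] theorem hitProbBefore_zero (x y : X) : hitProbBefore p 0 x y = 0 := by
  simp [hitProbBefore]

theorem hitProbBefore_succ_of_ne (k : ℕ) {x y : X} (h : x ≠ y) :
    hitProbBefore p (k + 1) x y = ∫⁻ z, hitProbBefore p k z y ∂(p x).toMeasure := by
  have : pathCons x ⁻¹' {ξ : ℕ → X | ∃ j < k + 1, ξ j = y} = {ξ : ℕ → X | ∃ j < k, ξ j = y} := by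
    ext ω
    constructor
    · rintro ⟨_ | j, hk, hj⟩
      · exact absurd hj h
      · exact ⟨j, by omega, hj⟩
    · rintro ⟨j, hk, hj⟩
      exact ⟨j + 1, by omega, hj⟩
  rw [hitProbBefore, chainKernel_stepKernel_apply p x (measurableSet_visitBefore _ y), this]
  rfl

theorem hitProbBefore_mono (x y : X) : Monotone fun k => hitProbBefore p k x y :=
  fun _ _ hkl => measure_mono fun _ ⟨j, hj, h⟩ => ⟨j, hj.trans_le hkl, h⟩

theorem hitProb_eq_iSup (x y : X) : hitProb p x y = ⨆ k, hitProbBefore p k x y := by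
  have : {ξ : ℕ → X | ∃ j, ξ j = y} = ⋃ k, {ξ : ℕ → X | ∃ j < k, ξ j = y} := by
    ext ξ
    rw [Set.mem_iUnion]
    exact ⟨fun ⟨j, h⟩ => ⟨j + 1, j, j.lt_succ_self, h⟩, fun ⟨_, j, _, h⟩ => ⟨j, h⟩⟩
  rw [hitProb, this, Monotone.measure_iUnion]
  · rfl
  · exact fun _ _ hkl _ ⟨j, hj, h⟩ => ⟨j, hj.trans_le hkl, h⟩

theorem hitProbBefore_le (k : ℕ) (x y : X) : hitProbBefore p k x y ≤ hitProb p x y :=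
  measure_mono fun _ ⟨j, _, h⟩ => ⟨j, h⟩

theorem hitProb_of_absorbing {x y : X} (hx : p x = PMF.pure x) (h : x ≠ y) :
    hitProb p x y = 0 := by
  rw [hitProb_eq_iSup]
  refine le_antisymm (iSup_le fun k => ?_) zero_le
  induction k with
  | zero => simp
  | succ k ih =>
    rw [hitProbBefore_succ_of_ne p k h, hx, PMF.toMeasure_pure, lintegral_dirac]
    exact ih

theorem lintegral_toMeasure_map {S : Type*} [Fintype S] [MeasurableSpace S]
    [DiscreteMeasurableSpace S] (q : PMF S) (g : S → X) (f : X → ℝ≥0∞) :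
    ∫⁻ x, f x ∂(q.map g).toMeasure = ∑ s, q s * f (g s) := by
  rw [← PMF.toMeasure_map (f := g) q .of_discrete, lintegral_map .of_discrete .of_discrete,
    lintegral_fintype]
  refine Finset.sum_congr rfl fun s _ => ?_
  rw [PMF.toMeasure_apply_singleton _ _ (measurableSet_singleton s), mul_comm]

theorem MDP.reach_eq_hitProb {A : Type*} (M : MDP X A) (σ : M.Scheduler) (y : X) :
    M.reach σ y = hitProb (M.step σ) M.init y := by
  rw [MDP.reach, MDP.pathMeasure, chainLaw_dirac, hitProb]

end Hitting

theorem PMF.sum_mul_add_const {S : Type*} [Fintype S] (q : PMF S) (f : S → ℝ≥0∞) (c : ℝ≥0∞) :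
    ∑ s, q s * (f s + c) = ∑ s, q s * f s + c := by
  have h : ∑ s, q s = 1 := by rw [← tsum_fintype (L := .unconditional _), PMF.tsum_coe]
  simp only [mul_add, Finset.sum_add_distrib, ← Finset.sum_mul, h, one_mul]

/-! ### The probability of satisfying the evidence, by backward recursion -/

section EvidenceValue

variable {S C : Type*} [Fintype S] [DecidableEq S] {n : ℕ}

open Classical in
/-- `evidenceValue 𝒞 ρ h i s` is the expectation of `h (π(t_d))` on the event that the labels at
the times `tᵢ, …, t_d` are the observed ones, for the CTMC that is in `s` at time `tᵢ`. It is
defined by backward recursion along `ρ`; as the times of `ρ` increase, the subtraction in `ℝ≥0` does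
not truncate. -/
noncomputable def evidenceValue (𝒞 : CTMC S C) (ρ : Evidence C (n + 1)) (h : S → ℝ≥0∞) :
    Fin (n + 1) → S → ℝ≥0∞ :=
  Fin.reverseInduction (motive := fun _ => S → ℝ≥0∞)
    (fun s => if 𝒞.L s = ρ.label (Fin.last n) then h s else 0)
    fun i v s => if 𝒞.L s = ρ.label i.castSucc then
      ∑ r, 𝒞.transient s (ρ.time i.succ - ρ.time i.castSucc) r * v r else 0

/-- The expectation of `h (π(t_d))` on the event that `π` satisfies the evidence `ρ`. -/
noncomputable def evidenceMass (𝒞 : CTMC S C) (ρ : Evidence C (n + 1)) (h : S → ℝ≥0∞) : ℝ≥0∞ :=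
  ∑ r, 𝒞.transient 𝒞.init (ρ.time 0) r * evidenceValue 𝒞 ρ h 0 r

variable (𝒞 : CTMC S C) (ρ : Evidence C (n + 1)) (h : S → ℝ≥0∞)

open Classical in
theorem evidenceValue_last (s : S) :
    evidenceValue 𝒞 ρ h (Fin.last n) s = if 𝒞.L s = ρ.label (Fin.last n) then h s else 0 := by
  simp [evidenceValue]

open Classical in
theorem evidenceValue_castSucc (i : Fin n) (s : S) :
    evidenceValue 𝒞 ρ h i.castSucc s = if 𝒞.L s = ρ.label i.castSucc then
      ∑ r, 𝒞.transient s (ρ.time i.succ - ρ.time i.castSucc) r * evidenceValue 𝒞 ρ h i.succ r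
      else 0 := by
  simp [evidenceValue]

theorem evidenceValue_sum {ι : Type*} [Fintype ι] (g : ι → S → ℝ≥0∞) (i : Fin (n + 1)) (s : S) :
    evidenceValue 𝒞 ρ (fun s => ∑ a, g a s) i s = ∑ a, evidenceValue 𝒞 ρ (g a) i s := by
  induction i using Fin.reverseInduction generalizing s with
  | last => simp only [evidenceValue_last]; split_ifs <;> simp
  | cast i ih =>
    simp only [evidenceValue_castSucc]
    split_ifs
    · simp only [ih, Finset.mul_sum]
      exact Finset.sum_comm
    · simp

theorem evidenceMass_sum {ι : Type*} [Fintype ι] (g : ι → S → ℝ≥0∞) :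
    evidenceMass 𝒞 ρ (fun s => ∑ a, g a s) = ∑ a, evidenceMass 𝒞 ρ (g a) := by
  simp only [evidenceMass, evidenceValue_sum, Finset.mul_sum]
  exact Finset.sum_comm

theorem evidenceMass_one :
    evidenceMass 𝒞 ρ 1 = ∑ s, evidenceMass 𝒞 ρ (Pi.single s 1) := by
  rw [← evidenceMass_sum]
  congr 1
  funext s
  simp [Pi.single_apply]

theorem evidenceMass_le_one : evidenceMass 𝒞 ρ 1 ≤ 1 := by
  have hv : ∀ (i : Fin (n + 1)) (s : S), evidenceValue 𝒞 ρ 1 i s ≤ 1 := by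
    intro i
    induction i using Fin.reverseInduction with
    | last => intro s; rw [evidenceValue_last]; split_ifs <;> simp
    | cast i ih =>
      intro s
      rw [evidenceValue_castSucc]
      split_ifs
      · refine (Finset.sum_le_sum fun r _ => mul_le_mul_right (ih r) _).trans ?_
        simpa using (PMF.sum_mul_add_const (𝒞.transient s _) 0 1).le
      · exact zero_le
  refine (Finset.sum_le_sum fun r _ => mul_le_mul_right (hv 0 r) _).trans ?_
  simpa using (PMF.sum_mul_add_const (𝒞.transient 𝒞.init (ρ.time 0)) 0 1).le

end EvidenceValue

/-! ### Reachability in the conditioned MDP -/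

namespace ImpreciseEvidence

variable {C : Type*}

theorem timing_nonempty {d : ℕ} (Ω : ImpreciseEvidence C d) (i : Fin d) :
    (Ω.timing i).Nonempty := by
  obtain ⟨ρ, hρ⟩ := Ω.instances_nonempty
  exact ⟨_, hρ.1 i⟩

theorem lt_of_mem_timing {d : ℕ} (Ω : ImpreciseEvidence C d) {i j : Fin d} (hij : i < j)
    {t u : ℝ≥0} (ht : t ∈ Ω.timing i) (hu : u ∈ Ω.timing j) : t < u := by
  have hstep : ∀ (i j : Fin d), (i : ℕ) + 1 = j → ∀ t ∈ Ω.timing i, ∀ u ∈ Ω.timing j, t < u := by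
    intro i j h t ht u hu
    obtain ⟨I, hI, htI⟩ := Set.mem_iUnion₂.1 ht
    obtain ⟨J, hJ, huJ⟩ := Set.mem_iUnion₂.1 hu
    exact htI.2.trans_lt ((Ω.ordered i j h I hI J hJ).trans_le huJ.1)
  obtain ⟨k, hk⟩ := Nat.exists_eq_add_of_lt (Fin.lt_def.1 hij)
  clear hij
  induction k generalizing j u with
  | zero => exact hstep i j hk.symm t ht u hu
  | succ k ih =>
    let l : Fin d := ⟨i + k + 1, by omega⟩
    obtain ⟨v, hv⟩ := Ω.timing_nonempty l
    exact (ih (j := l) hv rfl).trans (hstep l j hk.symm v hv u hu)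

theorem timing_injective {d : ℕ} (Ω : ImpreciseEvidence C d) {i j : Fin d} {t : ℝ≥0}
    (hi : t ∈ Ω.timing i) (hj : t ∈ Ω.timing j) : i = j := by
  rcases lt_trichotomy i j with h | h | h
  · exact absurd (Ω.lt_of_mem_timing h hi hj) (lt_irrefl t)
  · exact h
  · exact absurd (Ω.lt_of_mem_timing h hj hi) (lt_irrefl t)

theorem pos_of_mem_timing {d : ℕ} (Ω : ImpreciseEvidence C d) {i : Fin d} {t : ℝ≥0}
    (ht : t ∈ Ω.timing i) : 0 < t := by
  obtain ⟨I, hI, htI⟩ := Set.mem_iUnion₂.1 ht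
  exact (Ω.intervals_pos i I hI).trans_le htI.1

variable {n : ℕ} {Ω : ImpreciseEvidence C (n + 1)} {ρ : Evidence C (n + 1)}

theorem time_mem_nodes (hρ : ρ ∈ Ω.instances) (i : Fin (n + 1)) :
    (ρ.time i : ℝ≥0∞) ∈ Ω.graph.nodes :=
  Set.mem_biUnion hρ (by simp [Evidence.graph])

theorem top_mem_nodes (Ω : ImpreciseEvidence C (n + 1)) : (∞ : ℝ≥0∞) ∈ Ω.graph.nodes := by
  obtain ⟨ρ, hρ⟩ := Ω.instances_nonempty
  exact Set.mem_biUnion hρ (by simp [Evidence.graph])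

end ImpreciseEvidence

section UnfoldedStates

variable {S C : Type*} {n : ℕ} {𝒞 : CTMC S C} {Ω : ImpreciseEvidence C (n + 1)}
  {ρ : Evidence C (n + 1)}

theorem mem_resetStates_iff (hρ : ρ ∈ Ω.instances) {q : UnfoldedState S Ω.graph}
    {i : Fin (n + 1)} (hq : (q.time : ℝ≥0∞) = ρ.time i) :
    q ∈ resetStates 𝒞 Ω ↔ 𝒞.L q.state ≠ ρ.label i := by
  rw [hρ.2]
  constructor
  · rintro ⟨j, t, ht, hqt, hL⟩
    rw [hq, ENNReal.coe_inj] at hqt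
    rwa [Ω.timing_injective (hρ.1 i) (hqt ▸ ht)]
  · exact fun hL => ⟨i, ρ.time i, hρ.1 i, hq, hL⟩

theorem notMem_resetStates_of_time_zero {q : UnfoldedState S Ω.graph}
    (hq : (q.time : ℝ≥0∞) = 0) : q ∉ resetStates 𝒞 Ω := by
  rintro ⟨j, t, ht, hqt, -⟩
  rw [hq] at hqt
  exact (Ω.pos_of_mem_timing ht).ne' (ENNReal.coe_eq_zero.1 hqt.symm)

theorem ne_terminal_of_time_eq_coe {q : UnfoldedState S Ω.graph} {t : ℝ≥0}
    (hq : (q.time : ℝ≥0∞) = t) (s : S) : q ≠ terminal Ω s := by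
  rintro rfl
  exact ENNReal.coe_ne_top hq.symm

end UnfoldedStates

section Conditioned

variable {S C : Type*} [Fintype S] [DecidableEq S] {n : ℕ} {𝒞 : CTMC S C}
  {Ω : ImpreciseEvidence C (n + 1)} {ρ : Evidence C (n + 1)}
  {σ : (unfoldedMDP 𝒞 Ω.graph).Scheduler}

open Classical in
theorem conditionedMDP_step {q : UnfoldedState S Ω.graph} {t' : Ω.graph.nodes}
    (h : (unfoldedMDP 𝒞 Ω.graph).Chooses σ q t') :
    (conditionedMDP 𝒞 Ω).step σ q =
      if q ∈ resetStates 𝒞 Ω then PMF.pure ⟨𝒞.init, ⟨0, Ω.graph.zero_mem⟩⟩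
      else if (t' : ℝ≥0∞) = ∞ then PMF.pure ⟨q.state, t'⟩
      else (𝒞.transient q.state ((t' : ℝ≥0∞) - q.time).toNNReal).map fun s' => ⟨s', t'⟩ := by
  obtain ⟨h, rfl⟩ := h
  have h' : ((conditionedMDP 𝒞 Ω).enabled q).Nonempty := h
  rw [MDP.step, dif_pos h']
  rfl

theorem conditionedMDP_step_terminal (s : S) :
    (conditionedMDP 𝒞 Ω).step σ (terminal Ω s) = PMF.pure (terminal Ω s) := by
  have h : ¬ ((conditionedMDP 𝒞 Ω).enabled (terminal Ω s)).Nonempty := by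
    rintro ⟨t', ht'⟩
    have := Ω.graph.edge_lt ht'
    exact not_top_lt this
  rw [MDP.step, dif_neg h]

theorem conditionedMDP_step_last (hρ : ρ ∈ Ω.instances) (hσ : SchedulerConsistent σ ρ)
    {q : UnfoldedState S Ω.graph} (hq : (q.time : ℝ≥0∞) = ρ.time (Fin.last n))
    (hL : 𝒞.L q.state = ρ.label (Fin.last n)) :
    (conditionedMDP 𝒞 Ω).step σ q = PMF.pure (terminal Ω q.state) := by
  rw [conditionedMDP_step ((hσ q ⟨_, Ω.top_mem_nodes⟩).2.2 hq rfl),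
    if_neg (by simpa [mem_resetStates_iff hρ hq] using hL), if_pos rfl]
  rfl

theorem conditionedMDP_step_reset (hρ : ρ ∈ Ω.instances) (hσ : SchedulerConsistent σ ρ)
    {q : UnfoldedState S Ω.graph} {i : Fin (n + 1)} (hq : (q.time : ℝ≥0∞) = ρ.time i)
    (hL : 𝒞.L q.state ≠ ρ.label i) :
    (conditionedMDP 𝒞 Ω).step σ q = PMF.pure ⟨𝒞.init, ⟨0, Ω.graph.zero_mem⟩⟩ := by
  obtain ⟨t', ht'⟩ : ∃ t', (unfoldedMDP 𝒞 Ω.graph).Chooses σ q t' := by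
    induction i using Fin.lastCases with
    | last => exact ⟨_, (hσ q ⟨_, Ω.top_mem_nodes⟩).2.2 hq rfl⟩
    | cast i => exact ⟨_, (hσ q ⟨_, Ω.time_mem_nodes hρ i.succ⟩).2.1 i hq rfl⟩
  rw [conditionedMDP_step ht', if_pos ((mem_resetStates_iff hρ hq).2 hL)]

theorem hitProb_terminal (s s' : S) :
    hitProb ((conditionedMDP 𝒞 Ω).step σ) (terminal Ω s') (terminal Ω s) =
      Pi.single (M := fun _ => ℝ≥0∞) s 1 s' := by
  by_cases h : s' = s
  · subst h
    rw [hitProb_self, Pi.single_eq_same]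
  · rw [Pi.single_eq_of_ne h, hitProb_of_absorbing _ (conditionedMDP_step_terminal s')]
    exact fun h' => h (congrArg UnfoldedState.state h')

variable [MeasurableSpace S] [DiscreteMeasurableSpace S]

theorem lintegral_step_of_time_zero (hρ : ρ ∈ Ω.instances) (hσ : SchedulerConsistent σ ρ)
    {q : UnfoldedState S Ω.graph} (hq : (q.time : ℝ≥0∞) = 0)
    (F : UnfoldedState S Ω.graph → ℝ≥0∞) :
    ∫⁻ q', F q' ∂((conditionedMDP 𝒞 Ω).step σ q).toMeasure =
      ∑ r, 𝒞.transient q.state (ρ.time 0) r * F ⟨r, _, Ω.time_mem_nodes hρ 0⟩ := by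
  rw [conditionedMDP_step ((hσ q ⟨_, Ω.time_mem_nodes hρ 0⟩).1 hq rfl),
    if_neg (notMem_resetStates_of_time_zero hq), if_neg ENNReal.coe_ne_top,
    lintegral_toMeasure_map]
  simp [hq]

theorem lintegral_step_castSucc (hρ : ρ ∈ Ω.instances) (hσ : SchedulerConsistent σ ρ)
    {q : UnfoldedState S Ω.graph} {i : Fin n} (hq : (q.time : ℝ≥0∞) = ρ.time i.castSucc)
    (hL : 𝒞.L q.state = ρ.label i.castSucc) (F : UnfoldedState S Ω.graph → ℝ≥0∞) :
    ∫⁻ q', F q' ∂((conditionedMDP 𝒞 Ω).step σ q).toMeasure =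
      ∑ r, 𝒞.transient q.state (ρ.time i.succ - ρ.time i.castSucc) r *
        F ⟨r, _, Ω.time_mem_nodes hρ i.succ⟩ := by
  rw [conditionedMDP_step ((hσ q ⟨_, Ω.time_mem_nodes hρ i.succ⟩).2.1 i hq rfl),
    if_neg (by simpa [mem_resetStates_iff hρ hq] using hL), if_neg ENNReal.coe_ne_top,
    lintegral_toMeasure_map]
  simp only [hq, ← ENNReal.coe_sub, ENNReal.toNNReal_coe]

/-- From a state at time `tᵢ`, the terminal state `⟨s,t⋆⟩` is reached either directly, along states
that match the evidence, or after a reset; the probability of not resetting is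
`evidenceValue 𝒞 ρ 1 i`. -/
theorem hitProb_add_evidenceValue (hρ : ρ ∈ Ω.instances) (hσ : SchedulerConsistent σ ρ) (s : S)
    (i : Fin (n + 1)) (q : UnfoldedState S Ω.graph) (hq : (q.time : ℝ≥0∞) = ρ.time i) :
    hitProb ((conditionedMDP 𝒞 Ω).step σ) q (terminal Ω s) + evidenceValue 𝒞 ρ 1 i q.state *
        hitProb ((conditionedMDP 𝒞 Ω).step σ) (conditionedMDP 𝒞 Ω).init (terminal Ω s) =
      evidenceValue 𝒞 ρ (Pi.single s 1) i q.state +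
        hitProb ((conditionedMDP 𝒞 Ω).step σ) (conditionedMDP 𝒞 Ω).init (terminal Ω s) := by
  set x := hitProb ((conditionedMDP 𝒞 Ω).step σ) (conditionedMDP 𝒞 Ω).init (terminal Ω s) with hx
  induction i using Fin.reverseInduction generalizing q with
  | last =>
    rw [hitProb_of_ne _ (ne_terminal_of_time_eq_coe hq s), evidenceValue_last, evidenceValue_last]
    by_cases hL : 𝒞.L q.state = ρ.label (Fin.last n)
    · rw [conditionedMDP_step_last hρ hσ hq hL, PMF.toMeasure_pure, lintegral_dirac,
        hitProb_terminal, if_pos hL, if_pos hL]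
      simp
    · rw [conditionedMDP_step_reset hρ hσ hq hL, PMF.toMeasure_pure, lintegral_dirac, if_neg hL,
        if_neg hL, zero_mul, add_zero, zero_add]
      rfl
  | cast i ih =>
    rw [hitProb_of_ne _ (ne_terminal_of_time_eq_coe hq s), evidenceValue_castSucc,
      evidenceValue_castSucc]
    by_cases hL : 𝒞.L q.state = ρ.label i.castSucc
    · rw [lintegral_step_castSucc hρ hσ hq hL, if_pos hL, if_pos hL, Finset.sum_mul,
        ← Finset.sum_add_distrib, ← PMF.sum_mul_add_const]
      refine Finset.sum_congr rfl fun r _ => ?_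
      rw [mul_assoc, ← mul_add, ih _ rfl]
    · rw [conditionedMDP_step_reset hρ hσ hq hL, PMF.toMeasure_pure, lintegral_dirac, if_neg hL,
        if_neg hL, zero_mul, add_zero, zero_add]
      rfl

/-- Within `k` steps, the terminal state is reached from a state at time `tᵢ` either directly, or
within `k` steps from the initial state. -/
theorem hitProbBefore_le_evidenceValue_add (hρ : ρ ∈ Ω.instances) (hσ : SchedulerConsistent σ ρ)
    (s : S) (k : ℕ) (i : Fin (n + 1)) (q : UnfoldedState S Ω.graph)
    (hq : (q.time : ℝ≥0∞) = ρ.time i) :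
    hitProbBefore ((conditionedMDP 𝒞 Ω).step σ) k q (terminal Ω s) ≤
      evidenceValue 𝒞 ρ (Pi.single s 1) i q.state +
        hitProbBefore ((conditionedMDP 𝒞 Ω).step σ) k (conditionedMDP 𝒞 Ω).init
          (terminal Ω s) := by
  induction i using Fin.reverseInduction generalizing q k with
  | last =>
    by_cases hL : 𝒞.L q.state = ρ.label (Fin.last n)
    · refine (hitProbBefore_le _ _ _ _).trans (le_add_right ?_)
      rw [hitProb_of_ne _ (ne_terminal_of_time_eq_coe hq s), evidenceValue_last,
        conditionedMDP_step_last hρ hσ hq hL, PMF.toMeasure_pure, lintegral_dirac,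
        hitProb_terminal, if_pos hL]
    · refine le_add_left ?_
      cases k with
      | zero => simp
      | succ k =>
        rw [hitProbBefore_succ_of_ne _ k (ne_terminal_of_time_eq_coe hq s),
          conditionedMDP_step_reset hρ hσ hq hL, PMF.toMeasure_pure, lintegral_dirac]
        exact hitProbBefore_mono _ _ _ k.le_succ
  | cast i ih =>
    cases k with
    | zero => simp
    | succ k =>
      rw [hitProbBefore_succ_of_ne _ k (ne_terminal_of_time_eq_coe hq s)]
      have hmono := hitProbBefore_mono ((conditionedMDP 𝒞 Ω).step σ) (conditionedMDP 𝒞 Ω).init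
        (terminal Ω s) k.le_succ
      by_cases hL : 𝒞.L q.state = ρ.label i.castSucc
      · rw [lintegral_step_castSucc hρ hσ hq hL, evidenceValue_castSucc, if_pos hL]
        refine le_trans ?_ (add_le_add_right hmono _)
        rw [← PMF.sum_mul_add_const]
        exact Finset.sum_le_sum fun r _ => mul_le_mul_right (ih k _ rfl) _
      · rw [conditionedMDP_step_reset hρ hσ hq hL, PMF.toMeasure_pure, lintegral_dirac]
        exact le_add_left hmono

/-- If no pass along `ρ` ends in `s`, then resets do not help to reach `⟨s,t⋆⟩` either. The fixed
point equation for `hitProb` alone does not show this when every pass is reset. -/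
theorem hitProbBefore_init_eq_zero (hρ : ρ ∈ Ω.instances) (hσ : SchedulerConsistent σ ρ)
    {s : S} (hs : evidenceMass 𝒞 ρ (Pi.single s 1) = 0) (k : ℕ) :
    hitProbBefore ((conditionedMDP 𝒞 Ω).step σ) k (conditionedMDP 𝒞 Ω).init (terminal Ω s) = 0 := by
  have hq : (((conditionedMDP 𝒞 Ω).init.time : ℝ≥0∞)) = (0 : ℝ≥0) := by rfl
  induction k with
  | zero => simp
  | succ k ih =>
    rw [hitProbBefore_succ_of_ne _ k (ne_terminal_of_time_eq_coe hq s),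
      lintegral_step_of_time_zero hρ hσ hq]
    refine le_antisymm ?_ zero_le
    refine (Finset.sum_le_sum fun r _ => mul_le_mul_right
      (hitProbBefore_le_evidenceValue_add hρ hσ s k 0 _ rfl) _).trans ?_
    simp only [ih, add_zero]
    exact hs.le

/-- Restarting until the evidence is satisfied amounts to conditioning on the evidence. -/
theorem reach_terminal (hρ : ρ ∈ Ω.instances) (hσ : SchedulerConsistent σ ρ) (s : S) :
    (conditionedMDP 𝒞 Ω).reach σ (terminal Ω s) =
      (evidenceMass 𝒞 ρ 1)⁻¹ * evidenceMass 𝒞 ρ (Pi.single s 1) := by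
  rw [MDP.reach_eq_hitProb]
  by_cases h0 : evidenceMass 𝒞 ρ 1 = 0
  · have hs : evidenceMass 𝒞 ρ (Pi.single s 1) = 0 := by
      rw [evidenceMass_one] at h0
      exact Finset.sum_eq_zero_iff.1 h0 s (Finset.mem_univ s)
    rw [hs, mul_zero, hitProb_eq_iSup]
    simp [hitProbBefore_init_eq_zero hρ hσ hs]
  have hq : (((conditionedMDP 𝒞 Ω).init.time : ℝ≥0∞)) = (0 : ℝ≥0) := by rfl
  set x := hitProb ((conditionedMDP 𝒞 Ω).step σ) (conditionedMDP 𝒞 Ω).init (terminal Ω s) with hx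
  have hxtop : x ≠ ∞ := ne_top_of_le_ne_top ENNReal.one_ne_top (hitProb_le_one _ _ _)
  have hstart : x = ∑ r, 𝒞.transient 𝒞.init (ρ.time 0) r *
      hitProb ((conditionedMDP 𝒞 Ω).step σ) ⟨r, _, Ω.time_mem_nodes hρ 0⟩ (terminal Ω s) := by
    rw [hx, hitProb_of_ne _ (ne_terminal_of_time_eq_coe hq s), lintegral_step_of_time_zero hρ hσ hq]
    rfl
  -- summing over the states at `t₁`; cancelling `x` is possible as it is finite
  have key : x + evidenceMass 𝒞 ρ 1 * x = x + evidenceMass 𝒞 ρ (Pi.single s 1) := by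
    nth_rw 1 [hstart]
    rw [evidenceMass, evidenceMass, add_comm x (∑ r, _), Finset.sum_mul,
      ← Finset.sum_add_distrib, ← PMF.sum_mul_add_const]
    refine Finset.sum_congr rfl fun r _ => ?_
    have := hitProb_add_evidenceValue hρ hσ s 0 ⟨r, _, Ω.time_mem_nodes hρ 0⟩ rfl
    rw [← this, mul_add, mul_assoc]
  have h1 : evidenceMass 𝒞 ρ 1 ≠ ∞ := ne_top_of_le_ne_top ENNReal.one_ne_top (evidenceMass_le_one _ _)
  rw [← (ENNReal.add_right_inj hxtop).1 key, ← mul_assoc, ENNReal.inv_mul_cancel h0 h1, one_mul]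

end Conditioned

/-! ### Residence times and transient distributions -/

namespace CTMC

section Residence

variable {S C : Type*} (𝒞 : CTMC S C) (s : S)

theorem lintegral_residenceLaw {s : S} (hE : 𝒞.E s ≠ 0) {f : ℝ≥0∞ → ℝ≥0∞} (hf : Measurable f) :
    ∫⁻ u, f u ∂𝒞.residenceLaw s =
      ∫⁻ x : ℝ, exponentialPDF (𝒞.E s) x * f (ENNReal.ofReal x) := by
  have hpdf : Measurable (gammaPDF 1 (𝒞.E s : ℝ)) :=
    (measurable_exponentialPDFReal (𝒞.E s)).ennreal_ofReal
  rw [residenceLaw, if_neg hE, lintegral_map hf ENNReal.measurable_ofReal, expMeasure, gammaMeasure,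
    lintegral_withDensity_eq_lintegral_mul _ hpdf (g := fun x => f (ENNReal.ofReal x))
      (hf.comp ENNReal.measurable_ofReal)]
  rfl

/-- The residence time has density `E(s) e^{-E(s)x}` on every interval `[0,t]`; for `E(s) = 0` both
sides vanish, because the residence time is infinite. -/
theorem lintegral_residenceLaw_Iic (t : ℝ≥0) {f : ℝ≥0∞ → ℝ≥0∞} (hf : Measurable f) :
    ∫⁻ u, (Set.Iic (t : ℝ≥0∞)).indicator f u ∂𝒞.residenceLaw s =
      ∫⁻ x in Set.Icc (0 : ℝ) t,
        ENNReal.ofReal (𝒞.E s * Real.exp (-(𝒞.E s * x))) * f (ENNReal.ofReal x) := by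
  by_cases hE : 𝒞.E s = 0
  · rw [residenceLaw, if_pos hE, lintegral_dirac, Set.indicator_of_notMem (by simp)]
    simp [hE]
  rw [𝒞.lintegral_residenceLaw hE (hf.indicator measurableSet_Iic),
    ← lintegral_indicator measurableSet_Icc]
  refine lintegral_congr fun x => ?_
  rcases lt_or_ge x 0 with hx | hx
  · rw [exponentialPDF_of_neg hx, zero_mul, Set.indicator_of_notMem]
    exact fun h => hx.not_ge h.1
  · rw [exponentialPDF_of_nonneg hx]
    by_cases hxt : x ≤ t
    · rw [Set.indicator_of_mem (Set.mem_Icc.2 ⟨hx, hxt⟩), Set.indicator_of_mem]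
      simpa using hxt
    · rw [Set.indicator_of_notMem (fun h => hxt (Set.mem_Icc.1 h).2), Set.indicator_of_notMem,
        mul_zero]
      simpa using hxt

/-- Memorylessness of the residence time. -/
theorem lintegral_residenceLaw_Ioi (t : ℝ≥0) {f : ℝ≥0∞ → ℝ≥0∞} (hf : Measurable f) :
    ∫⁻ u, (Set.Ioi (t : ℝ≥0∞)).indicator (fun u => f (u - t)) u ∂𝒞.residenceLaw s =
      ENNReal.ofReal (Real.exp (-(𝒞.E s * t))) *
        ∫⁻ u, (Set.Ioi 0).indicator f u ∂𝒞.residenceLaw s := by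
  by_cases hE : 𝒞.E s = 0
  · rw [residenceLaw, if_pos hE, lintegral_dirac, lintegral_dirac,
      Set.indicator_of_mem (Set.mem_Ioi.2 ENNReal.coe_lt_top), Set.indicator_of_mem (by simp)]
    simp [hE]
  have hf' : Measurable fun u : ℝ≥0∞ => f (u - t) := hf.comp (measurable_id.sub_const _)
  have hpdf : Measurable (exponentialPDF (𝒞.E s : ℝ)) :=
    (measurable_exponentialPDFReal (𝒞.E s)).ennreal_ofReal
  rw [𝒞.lintegral_residenceLaw hE (hf'.indicator measurableSet_Ioi),
    𝒞.lintegral_residenceLaw hE (hf.indicator measurableSet_Ioi),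
    ← lintegral_const_mul' _ _ ENNReal.ofReal_ne_top,
    ← lintegral_add_right_eq_self _ (t : ℝ)]
  refine lintegral_congr fun x => ?_
  rcases le_or_gt x 0 with hx | hx
  · rw [Set.indicator_of_notMem, Set.indicator_of_notMem]
    · simp
    · simpa using hx
    · simpa using hx
  · have h1 : ENNReal.ofReal (x + t) = ENNReal.ofReal x + t := by
      rw [ENNReal.ofReal_add hx.le t.coe_nonneg, ENNReal.ofReal_coe_nnreal]
    have h2 : 0 < ENNReal.ofReal x := ENNReal.ofReal_pos.2 hx
    rw [h1, Set.indicator_of_mem, Set.indicator_of_mem (Set.mem_Ioi.2 h2),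
      ENNReal.add_sub_cancel_right ENNReal.coe_ne_top, exponentialPDF_of_nonneg hx.le,
      exponentialPDF_of_nonneg (add_nonneg hx.le t.coe_nonneg), ← mul_assoc,
      ← ENNReal.ofReal_mul (Real.exp_nonneg _)]
    · congr 2
      rw [mul_left_comm, ← Real.exp_add]
      congr 2
      ring
    · rw [Set.mem_Ioi, add_comm]
      exact ENNReal.lt_add_right ENNReal.coe_ne_top h2.ne'

theorem residenceLaw_zero : 𝒞.residenceLaw s {0} = 0 := by
  have h := 𝒞.lintegral_residenceLaw_Iic s 0 (f := 1) measurable_one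
  have h0 : Set.Iic (((0 : ℝ≥0)) : ℝ≥0∞) = {0} := by ext; simp
  rw [h0, lintegral_indicator_one (measurableSet_singleton _)] at h
  rw [h]
  simp

theorem ae_residenceLaw_ne_zero : ∀ᵐ u ∂𝒞.residenceLaw s, u ≠ 0 := by
  rw [ae_iff]
  simpa using 𝒞.residenceLaw_zero s

theorem residenceLaw_Iic_lt_one (t : ℝ≥0) : 𝒞.residenceLaw s (Set.Iic t) < 1 := by
  have h := 𝒞.lintegral_residenceLaw_Ioi s t (f := 1) measurable_one
  have h0 : (Set.Ioi (0 : ℝ≥0∞)) = {0}ᶜ := by ext; simp [pos_iff_ne_zero]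
  change ∫⁻ u, (Set.Ioi (t : ℝ≥0∞)).indicator 1 u ∂𝒞.residenceLaw s = _ at h
  rw [lintegral_indicator_one measurableSet_Ioi, lintegral_indicator_one measurableSet_Ioi, h0,
    prob_compl_eq_one_sub (measurableSet_singleton _), residenceLaw_zero, tsub_zero, mul_one] at h
  have h1 : 𝒞.residenceLaw s (Set.Iic t) + 𝒞.residenceLaw s (Set.Ioi t) = 1 := by
    rw [← Set.compl_Iic]
    exact prob_add_prob_compl measurableSet_Iic
  refine lt_of_le_of_ne prob_le_one fun h2 => ?_
  rw [h2, h] at h1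
  have h3 : (1 : ℝ≥0∞) < 1 + ENNReal.ofReal (Real.exp (-(𝒞.E s * t))) :=
    ENNReal.lt_add_right ENNReal.one_ne_top (ENNReal.ofReal_pos.2 (Real.exp_pos _)).ne'
  exact h3.ne' h1

end Residence

section Renewal

variable {S C : Type*} [Fintype S] (𝒞 : CTMC S C)

/-- A family bounded by `1` that satisfies the renewal equation is at most any other solution with
the same inhomogeneity, so that bounded solutions are unique. The reason is that no jump occurs
before a fixed time with positive probability, uniformly in the state. -/
theorem renewal_le (c : S → ℝ≥0 → ℝ≥0∞) (F G : S → ℝ≥0 → ℝ≥0∞) (hF1 : ∀ s t, F s t ≤ 1)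
    (hF : ∀ s t, F s t = c s t + ∫⁻ u, (Set.Iic (t : ℝ≥0∞)).indicator
        (fun u => ∑ q, 𝒞.Δ s q * F q (t - u.toNNReal)) u ∂𝒞.residenceLaw s)
    (hG : ∀ s t, G s t = c s t + ∫⁻ u, (Set.Iic (t : ℝ≥0∞)).indicator
        (fun u => ∑ q, 𝒞.Δ s q * G q (t - u.toNNReal)) u ∂𝒞.residenceLaw s) (s : S) (t : ℝ≥0) :
    F s t ≤ G s t := by
  obtain ⟨δ, hδ1, hδ⟩ : ∃ δ < 1, ∀ s, 𝒞.residenceLaw s (Set.Iic t) ≤ δ :=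
    ⟨Finset.univ.sup fun s => 𝒞.residenceLaw s (Set.Iic t),
      (Finset.sup_lt_iff (by simp)).2 fun s _ => 𝒞.residenceLaw_Iic_lt_one s t,
      fun s => Finset.le_sup (f := fun s => 𝒞.residenceLaw s (Set.Iic t)) (Finset.mem_univ s)⟩
  -- each substitution into the equation gains a factor `δ`
  have key : ∀ k : ℕ, ∀ s, ∀ v ≤ t, F s v ≤ G s v + δ ^ k := by
    intro k
    induction k with
    | zero =>
      intro s v _
      rw [pow_zero]
      exact (hF1 s v).trans le_add_self
    | succ k ih =>
      intro s v hv
      rw [hF, hG, add_assoc]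
      refine add_le_add_right ?_ _
      have hle : ∀ u, (Set.Iic (v : ℝ≥0∞)).indicator
          (fun u => ∑ q, 𝒞.Δ s q * F q (v - u.toNNReal)) u ≤
          (Set.Iic (v : ℝ≥0∞)).indicator (fun u => ∑ q, 𝒞.Δ s q * G q (v - u.toNNReal)) u +
          (Set.Iic (t : ℝ≥0∞)).indicator (fun _ => δ ^ k) u := by
        intro u
        by_cases hu : u ∈ Set.Iic (v : ℝ≥0∞)
        · have hut : u ∈ Set.Iic (t : ℝ≥0∞) := le_trans hu (ENNReal.coe_le_coe.2 hv)
          rw [Set.indicator_of_mem hu, Set.indicator_of_mem hu, Set.indicator_of_mem hut,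
            ← PMF.sum_mul_add_const]
          exact Finset.sum_le_sum fun q _ => mul_le_mul_right (ih q _ (tsub_le_self.trans hv)) _
        · rw [Set.indicator_of_notMem hu]
          exact zero_le
      refine (lintegral_mono hle).trans ?_
      rw [lintegral_add_right _ (measurable_const.indicator measurableSet_Iic),
        lintegral_indicator_const measurableSet_Iic, pow_succ]
      exact add_le_add_right (mul_le_mul_right (hδ s) _) _
  have hlim : Filter.Tendsto (fun k : ℕ => G s t + δ ^ k) Filter.atTop (nhds (G s t + 0)) :=
    tendsto_const_nhds.add (ENNReal.tendsto_pow_atTop_nhds_zero_of_lt_one hδ1)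
  rw [add_zero] at hlim
  exact ge_of_tendsto' hlim fun k => key k s t le_rfl

end Renewal

section Backward

variable {S C : Type*} [Fintype S] [DecidableEq S] (𝒞 : CTMC S C)

section Deriv

attribute [local instance] Matrix.linftyOpNormedRing Matrix.linftyOpNormedAlgebra

/-- Kolmogorov's backward equation for the matrix exponential. -/
theorem hasDerivAt_exp_smul_apply (A : Matrix S S ℝ) (s r : S) (t : ℝ) :
    HasDerivAt (fun t : ℝ => NormedSpace.exp (t • A) s r)
      (∑ q, A s q * NormedSpace.exp (t • A) q r) t := by
  have h := hasDerivAt_exp_smul_const' (𝕂 := ℝ) A t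
  have h2 := (hasDerivAt_pi.1 ((hasDerivAt_pi.1 h) s)) r
  rwa [Matrix.mul_apply] at h2

end Deriv

theorem continuous_exp_smul_apply (A : Matrix S S ℝ) (s r : S) :
    Continuous fun t : ℝ => NormedSpace.exp (t • A) s r :=
  continuous_iff_continuousAt.2 fun t => (hasDerivAt_exp_smul_apply A s r t).continuousAt

/-- Variation of constants for the linear equation `y' = e g - e y`. -/
theorem eq_add_integral_of_hasDerivAt {y g : ℝ → ℝ} (e : ℝ)
    (hy : ∀ u, HasDerivAt y (e * g u - e * y u) u) (hg : Continuous g) (t : ℝ) :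
    y t = Real.exp (-(e * t)) * y 0 +
      ∫ u in (0 : ℝ)..t, e * Real.exp (-(e * u)) * g (t - u) := by
  have hd : ∀ u, HasDerivAt (fun u => -Real.exp (-(e * u)) * y (t - u))
      (e * Real.exp (-(e * u)) * g (t - u)) u := by
    intro u
    have h1 : HasDerivAt (fun u => y (t - u)) (-(e * g (t - u) - e * y (t - u))) u :=
      (hy (t - u)).comp_const_sub t u
    refine ((hasDerivAt_neg_exp_mul_exp (r := e) (x := u)).mul h1).congr_deriv ?_
    ring
  have hcont : Continuous fun u => e * Real.exp (-(e * u)) * g (t - u) := by fun_prop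
  rw [intervalIntegral.integral_eq_sub_of_hasDerivAt (fun u _ => hd u)
    (hcont.intervalIntegrable _ _)]
  simp

theorem generator_sum_mul (s : S) (v : S → ℝ) :
    ∑ q, 𝒞.generator s q * v q =
      𝒞.E s * (∑ q, (𝒞.Δ s q).toReal * v q) - 𝒞.E s * v s := by
  simp [generator, rate, Matrix.sub_apply, sub_mul, Finset.sum_sub_distrib,
    Matrix.diagonal_apply, Finset.mul_sum, mul_assoc, mul_left_comm]

theorem continuous_sum_exp_smul_generator (s r : S) : Continuous fun t : ℝ =>
    ∑ q, (𝒞.Δ s q).toReal * NormedSpace.exp (t • 𝒞.generator) q r :=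
  continuous_finsetSum _ fun q _ => continuous_const.mul (continuous_exp_smul_apply _ q r)

/-- Kolmogorov's backward equation in integrated form. -/
theorem exp_smul_generator_apply (s r : S) (t : ℝ) :
    NormedSpace.exp (t • 𝒞.generator) s r =
      Real.exp (-(𝒞.E s * t)) * (1 : Matrix S S ℝ) s r +
        ∫ u in (0 : ℝ)..t, 𝒞.E s * Real.exp (-(𝒞.E s * u)) *
          ∑ q, (𝒞.Δ s q).toReal * NormedSpace.exp ((t - u) • 𝒞.generator) q r := by
  have h := eq_add_integral_of_hasDerivAt (y := fun t => NormedSpace.exp (t • 𝒞.generator) s r)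
    (g := fun t => ∑ q, (𝒞.Δ s q).toReal * NormedSpace.exp (t • 𝒞.generator) q r) (𝒞.E s)
    (fun u => (hasDerivAt_exp_smul_apply 𝒞.generator s r u).congr_deriv
      (generator_sum_mul 𝒞 s fun q => NormedSpace.exp (u • 𝒞.generator) q r))
    (𝒞.continuous_sum_exp_smul_generator s r) t
  rwa [zero_smul, NormedSpace.exp_zero] at h

theorem exp_smul_generator_nonneg (s r : S) {t : ℝ} (ht : 0 ≤ t) :
    0 ≤ NormedSpace.exp (t • 𝒞.generator) s r :=
  exp_apply_nonneg_of_offDiag _ (fun i j hij => mul_nonneg ht (𝒞.generator_nonneg i j hij)) _ _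

theorem transient_apply (s r : S) (t : ℝ≥0) :
    𝒞.transient s t r = ENNReal.ofReal (NormedSpace.exp ((t : ℝ) • 𝒞.generator) s r) := rfl

theorem measurable_transient_sub (s r : S) (t : ℝ≥0) :
    Measurable fun u : ℝ≥0∞ => 𝒞.transient s (t - u.toNNReal) r := by
  have h2 : Measurable fun u : ℝ≥0∞ => ((t - u.toNNReal : ℝ≥0) : ℝ) :=
    (measurable_const.sub ENNReal.measurable_toNNReal).coe_nnreal_real
  exact ((continuous_exp_smul_apply 𝒞.generator s r).measurable.comp h2).ennreal_ofReal

/-- The transient probabilities satisfy the renewal equation at the first jump. -/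
theorem transient_renewal (s r : S) (t : ℝ≥0) :
    𝒞.transient s t r = ENNReal.ofReal (Real.exp (-(𝒞.E s * t))) * (if s = r then 1 else 0) +
      ∫⁻ u, (Set.Iic (t : ℝ≥0∞)).indicator
        (fun u => ∑ q, 𝒞.Δ s q * 𝒞.transient q (t - u.toNNReal) r) u ∂𝒞.residenceLaw s := by
  have hm : Measurable fun u : ℝ≥0∞ => ∑ q, 𝒞.Δ s q * 𝒞.transient q (t - u.toNNReal) r :=
    Finset.measurable_sum _ fun q _ => (𝒞.measurable_transient_sub q r t).const_mul _
  have hcont : Continuous fun u : ℝ => 𝒞.E s * Real.exp (-(𝒞.E s * u)) *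
      ∑ q, (𝒞.Δ s q).toReal * NormedSpace.exp ((t - u) • 𝒞.generator) q r :=
    (show Continuous fun u : ℝ => 𝒞.E s * Real.exp (-(𝒞.E s * u)) by fun_prop).mul
      ((𝒞.continuous_sum_exp_smul_generator s r).comp (continuous_sub_left (t : ℝ)))
  have hnn : ∀ u ∈ Set.Icc (0 : ℝ) t, 0 ≤ 𝒞.E s * Real.exp (-(𝒞.E s * u)) *
      ∑ q, (𝒞.Δ s q).toReal * NormedSpace.exp ((t - u) • 𝒞.generator) q r := fun u hu =>
    mul_nonneg (mul_nonneg (𝒞.E s).coe_nonneg (Real.exp_nonneg _)) (Finset.sum_nonneg fun q _ =>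
      mul_nonneg ENNReal.toReal_nonneg (𝒞.exp_smul_generator_nonneg q r (sub_nonneg.2 hu.2)))
  have hint : ∫⁻ u, (Set.Iic (t : ℝ≥0∞)).indicator
        (fun u => ∑ q, 𝒞.Δ s q * 𝒞.transient q (t - u.toNNReal) r) u ∂𝒞.residenceLaw s =
      ENNReal.ofReal (∫ u in (0 : ℝ)..t, 𝒞.E s * Real.exp (-(𝒞.E s * u)) *
          ∑ q, (𝒞.Δ s q).toReal * NormedSpace.exp ((t - u) • 𝒞.generator) q r) := by
    rw [𝒞.lintegral_residenceLaw_Iic s t hm, intervalIntegral.integral_of_le t.coe_nonneg,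
      ← integral_Icc_eq_integral_Ioc, ofReal_integral_eq_lintegral_ofReal
        (hcont.integrableOn_Icc) ((ae_restrict_iff' measurableSet_Icc).2 (.of_forall hnn))]
    refine setLIntegral_congr_fun measurableSet_Icc fun u hu => ?_
    have hu0 : 0 ≤ u := hu.1
    have hut : u ≤ t := hu.2
    have h1 : ((t - (ENNReal.ofReal u).toNNReal : ℝ≥0) : ℝ) = t - u := by
      have : (ENNReal.ofReal u).toNNReal = u.toNNReal := rfl
      rw [this, NNReal.coe_sub (Real.toNNReal_le_iff_le_coe.2 hut), Real.coe_toNNReal u hu0]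
    rw [ENNReal.ofReal_mul (mul_nonneg (𝒞.E s).coe_nonneg (Real.exp_nonneg _)),
      ENNReal.ofReal_sum_of_nonneg fun q _ => mul_nonneg ENNReal.toReal_nonneg
        (𝒞.exp_smul_generator_nonneg q r (sub_nonneg.2 hut))]
    congr 1
    refine Finset.sum_congr rfl fun q _ => ?_
    rw [ENNReal.ofReal_mul ENNReal.toReal_nonneg, ENNReal.ofReal_toReal (PMF.apply_ne_top _ _),
      transient_apply, h1]
  rw [hint, transient_apply, exp_smul_generator_apply, ENNReal.ofReal_add, Matrix.one_apply,
    ENNReal.ofReal_mul (Real.exp_nonneg _)]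
  · split_ifs <;> simp
  · rw [Matrix.one_apply]
    split_ifs <;> simp [Real.exp_nonneg]
  · exact intervalIntegral.integral_nonneg t.coe_nonneg hnn

end Backward

end CTMC

/-! ### The Markov property of the state process -/

section InState

variable {S : Type*}

theorem inStateAt_pathCons_of_lt {t : ℝ≥0} {s r : S} {u : ℝ≥0∞} {ω : ℕ → S × ℝ≥0∞}
    (h : (t : ℝ≥0∞) < u) : InStateAt (pathCons (s, u) ω) t r ↔ s = r := by
  constructor
  · rintro ⟨k, hk, h1, -⟩
    cases k with
    | zero => exact hk
    | succ k =>
      rw [Finset.sum_range_succ'] at h1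
      exact absurd (h.trans_le (le_add_self.trans h1)) (lt_irrefl _)
  · rintro rfl
    exact ⟨0, rfl, by simp, by simpa using h⟩

theorem inStateAt_pathCons_of_le {t : ℝ≥0} {s r : S} {u : ℝ≥0∞} {ω : ℕ → S × ℝ≥0∞}
    (h : u ≤ t) : InStateAt (pathCons (s, u) ω) t r ↔ InStateAt ω (t - u.toNNReal) r := by
  lift u to ℝ≥0 using ne_top_of_le_ne_top ENNReal.coe_ne_top h
  have h' : u ≤ t := ENNReal.coe_le_coe.1 h
  have hsum : ∀ k, ∑ i ∈ Finset.range (k + 1), (pathCons (s, (u : ℝ≥0∞)) ω i).2 =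
      ∑ i ∈ Finset.range k, (ω i).2 + u := fun k => Finset.sum_range_succ' _ _
  have ht : (t : ℝ≥0∞) = ((t - u : ℝ≥0) : ℝ≥0∞) + u := by
    rw [← ENNReal.coe_add, tsub_add_cancel_of_le h']
  rw [ENNReal.toNNReal_coe]
  -- the jump times after the first jump are those of `ω`, delayed by `u`
  have hstep : ∀ k, (∑ i ∈ Finset.range (k + 1), (pathCons (s, (u : ℝ≥0∞)) ω i).2 ≤ t ↔
      ∑ i ∈ Finset.range k, (ω i).2 ≤ ((t - u : ℝ≥0) : ℝ≥0∞)) := fun k => by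
    rw [hsum, ht, ENNReal.add_le_add_iff_right ENNReal.coe_ne_top]
  constructor
  · rintro ⟨k, hk, h1, h2⟩
    cases k with
    | zero => exact absurd h2 (by simpa using h')
    | succ k => exact ⟨k, hk, (hstep k).1 h1, not_le.1 fun h3 => h2.not_ge ((hstep (k + 1)).2 h3)⟩
  · rintro ⟨k, hk, h1, h2⟩
    exact ⟨k + 1, hk, (hstep k).2 h1, not_le.1 fun h3 => h2.not_ge ((hstep (k + 1)).1 h3)⟩

theorem inStateAt_unique {π : ℕ → S × ℝ≥0∞} {t : ℝ≥0} {s r : S} (hs : InStateAt π t s)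
    (hr : InStateAt π t r) : s = r := by
  obtain ⟨k, rfl, h1, h2⟩ := hs
  obtain ⟨l, rfl, h3, h4⟩ := hr
  have key : ∀ k l : ℕ, (t : ℝ≥0∞) < ∑ i ∈ Finset.range (k + 1), (π i).2 →
      ∑ i ∈ Finset.range l, (π i).2 ≤ t → l ≤ k := by
    intro k l h h'
    by_contra hkl
    exact (h.trans_le ((Finset.sum_le_sum_of_subset
      (Finset.range_subset_range.2 (not_le.1 hkl))).trans h')).false
  rw [le_antisymm (key l k h4 h1) (key k l h2 h3)]

theorem measurableSet_inStateAt [MeasurableSpace S] [DiscreteMeasurableSpace S] (a : ℝ≥0) (s : S) :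
    MeasurableSet {p : ℝ≥0 × (ℕ → S × ℝ≥0∞) | InStateAt p.2 (p.1 + a) s} := by
  have h1 : ∀ k : ℕ, Measurable fun p : ℝ≥0 × (ℕ → S × ℝ≥0∞) => (p.2 k).1 := fun k =>
    measurable_fst.comp ((measurable_pi_apply k).comp measurable_snd)
  have h2 : ∀ k : ℕ, Measurable fun p : ℝ≥0 × (ℕ → S × ℝ≥0∞) =>
      ∑ i ∈ Finset.range k, (p.2 i).2 := fun k => Finset.measurable_sum _ fun i _ =>
    measurable_snd.comp ((measurable_pi_apply i).comp measurable_snd)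
  have h3 : Measurable fun p : ℝ≥0 × (ℕ → S × ℝ≥0∞) => ((p.1 + a : ℝ≥0) : ℝ≥0∞) :=
    (measurable_fst.add_const a).coe_nnreal_ennreal
  have : {p : ℝ≥0 × (ℕ → S × ℝ≥0∞) | InStateAt p.2 (p.1 + a) s} = ⋃ k : ℕ,
      ((fun p => (p.2 k).1) ⁻¹' {s} ∩
        ({p | ∑ i ∈ Finset.range k, (p.2 i).2 ≤ ((p.1 + a : ℝ≥0) : ℝ≥0∞)} ∩
          {p | ((p.1 + a : ℝ≥0) : ℝ≥0∞) < ∑ i ∈ Finset.range (k + 1), (p.2 i).2})) := by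
    ext p
    rw [Set.mem_iUnion]
    rfl
  rw [this]
  exact .iUnion fun k => (h1 k (measurableSet_singleton s)).inter
    ((measurableSet_le (h2 k) h3).inter (measurableSet_lt h3 (h2 (k + 1))))

theorem measurableSet_inStateAt_right [MeasurableSpace S] [DiscreteMeasurableSpace S]
    (t : ℝ≥0) (s : S) :
    MeasurableSet {π : ℕ → S × ℝ≥0∞ | InStateAt π t s} := by
  have := measurable_prodMk_left (x := (0 : ℝ≥0)) (measurableSet_inStateAt t s)
  simpa using this

/-- A family of events about timed paths such that `B t` depends only on the states from time `t`
on: it says about them what `B 0` says about the states from time `0` on. -/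
structure IsFutureEvent [MeasurableSpace S] (B : ℝ≥0 → Set (ℕ → S × ℝ≥0∞)) : Prop where
  measurableSet : MeasurableSet {p : ℝ≥0 × (ℕ → S × ℝ≥0∞) | p.2 ∈ B p.1}
  mem_of_lt : ∀ {t : ℝ≥0} {s : S} {u : ℝ≥0∞} {ω : ℕ → S × ℝ≥0∞}, (t : ℝ≥0∞) < u →
    (pathCons (s, u) ω ∈ B t ↔ pathCons (s, u - t) ω ∈ B 0)
  mem_of_le : ∀ {t : ℝ≥0} {s : S} {u : ℝ≥0∞} {ω : ℕ → S × ℝ≥0∞}, u ≤ t →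
    (pathCons (s, u) ω ∈ B t ↔ ω ∈ B (t - u.toNNReal))

theorem inStateAt_pathCons_add_of_lt {t a : ℝ≥0} {s r : S} {u : ℝ≥0∞} {ω : ℕ → S × ℝ≥0∞}
    (h : (t : ℝ≥0∞) < u) :
    InStateAt (pathCons (s, u) ω) (t + a) r ↔ InStateAt (pathCons (s, u - t) ω) (0 + a) r := by
  rw [zero_add]
  rcases lt_or_ge ((t + a : ℝ≥0) : ℝ≥0∞) u with h' | h'
  · rw [inStateAt_pathCons_of_lt h', inStateAt_pathCons_of_lt]
    rwa [ENNReal.coe_add, add_comm, ← lt_tsub_iff_right] at h'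
  · have h'' : u - t ≤ a := by rwa [tsub_le_iff_left, ← ENNReal.coe_add]
    rw [inStateAt_pathCons_of_le h', inStateAt_pathCons_of_le h'']
    lift u to ℝ≥0 using ne_top_of_le_ne_top ENNReal.coe_ne_top h'
    have htu : t ≤ u := (ENNReal.coe_lt_coe.1 h).le
    rw [← ENNReal.coe_sub, ENNReal.toNNReal_coe, ENNReal.toNNReal_coe]
    have : t + a - u = a - (u - t) := by
      rw [tsub_tsub_eq_add_tsub_of_le htu, add_comm]
    rw [this]

theorem inStateAt_pathCons_add_of_le {t a : ℝ≥0} {s r : S} {u : ℝ≥0∞} {ω : ℕ → S × ℝ≥0∞}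
    (h : u ≤ t) :
    InStateAt (pathCons (s, u) ω) (t + a) r ↔ InStateAt ω (t - u.toNNReal + a) r := by
  have h' : u ≤ ((t + a : ℝ≥0) : ℝ≥0∞) := h.trans (ENNReal.coe_le_coe.2 le_self_add)
  rw [inStateAt_pathCons_of_le h', tsub_add_eq_add_tsub]
  simpa using ENNReal.toNNReal_mono ENNReal.coe_ne_top h

end InState

namespace CTMC

variable {S C : Type*} [MeasurableSpace S] [DiscreteMeasurableSpace S] (𝒞 : CTMC S C)

/-- The law of the timed paths of `𝒞` started in the state `s`. -/
noncomputable def pathMeasureFrom (s : S) : Measure (ℕ → S × ℝ≥0∞) :=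
  chainLaw (𝒞.enterKernel s) 𝒞.jumpKernel

instance (s : S) : IsProbabilityMeasure (𝒞.pathMeasureFrom s) := by
  unfold pathMeasureFrom chainLaw; infer_instance

/-- The first step of a timed path: a residence time, and an independent path from the next
state. -/
theorem pathMeasureFrom_apply [Fintype S] (s : S) {A : Set (ℕ → S × ℝ≥0∞)} (hA : MeasurableSet A) :
    𝒞.pathMeasureFrom s A = ∫⁻ u, ∑ r, 𝒞.Δ s r *
      𝒞.pathMeasureFrom r (pathCons (s, u) ⁻¹' A) ∂𝒞.residenceLaw s := by
  have hc : ∀ x : S × ℝ≥0∞, Measurable (pathCons x) := fun x =>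
    measurable_pathCons.comp (measurable_const.prodMk measurable_id)
  have h1 : ∀ x : S × ℝ≥0∞, ∫⁻ ξ, A.indicator 1 ξ ∂chainKernel 𝒞.jumpKernel x =
      ∑ r, 𝒞.Δ x.1 r * 𝒞.pathMeasureFrom r (pathCons x ⁻¹' A) := by
    intro x
    rw [lintegral_chainKernel _ _ (measurable_one.indicator hA)]
    have h2 : ∀ y, ∫⁻ ω, A.indicator (1 : (ℕ → S × ℝ≥0∞) → ℝ≥0∞) (pathCons x ω)
        ∂chainKernel 𝒞.jumpKernel y = chainKernel 𝒞.jumpKernel y (pathCons x ⁻¹' A) := fun y => by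
      rw [← lintegral_indicator_one (hc x hA)]
      rfl
    simp only [h2]
    change ∫⁻ y, _ ∂(𝒞.enterKernel ∘ₖ stepKernel 𝒞.Δ) x.1 = _
    rw [Kernel.lintegral_comp _ _ _
      (Kernel.measurable_coe _ (hc x hA)), lintegral_fintype]
    refine Finset.sum_congr rfl fun r _ => ?_
    have h3 : stepKernel 𝒞.Δ x.1 {r} = 𝒞.Δ x.1 r :=
      PMF.toMeasure_apply_singleton _ _ (measurableSet_singleton r)
    rw [h3, mul_comm, pathMeasureFrom, chainLaw_eq_bind,
      Measure.bind_apply (hc x hA) (Kernel.aemeasurable _)]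
  have h4 : Measurable fun x : S × ℝ≥0∞ => ∫⁻ ξ, A.indicator 1 ξ ∂chainKernel 𝒞.jumpKernel x :=
    (measurable_one.indicator hA).lintegral_kernel
  rw [← lintegral_indicator_one hA, pathMeasureFrom,
    lintegral_chainLaw _ _ (measurable_one.indicator hA)]
  change ∫⁻ x, _ ∂((Measure.dirac s).prod (𝒞.residenceLaw s)) = _
  rw [lintegral_prod _ h4.aemeasurable, lintegral_dirac]
  simp only [h1]

variable [Fintype S]

/-- A future event at time `t` either happens because no jump occurs before `t` and the event
happens from the current state on, or it is shifted to the path after the first jump. -/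
theorem pathMeasureFrom_renewal {B : ℝ≥0 → Set (ℕ → S × ℝ≥0∞)} (hB : IsFutureEvent B) (s : S)
    (t : ℝ≥0) :
    𝒞.pathMeasureFrom s (B t) =
      ENNReal.ofReal (Real.exp (-(𝒞.E s * t))) * 𝒞.pathMeasureFrom s (B 0) +
      ∫⁻ u, (Set.Iic (t : ℝ≥0∞)).indicator
        (fun u => ∑ q, 𝒞.Δ s q * 𝒞.pathMeasureFrom q (B (t - u.toNNReal))) u
          ∂𝒞.residenceLaw s := by
  have hmeas : ∀ t, MeasurableSet (B t) := fun t => measurable_prodMk_left hB.measurableSet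
  set f : ℝ≥0∞ → ℝ≥0∞ := fun u =>
    ∑ q, 𝒞.Δ s q * 𝒞.pathMeasureFrom q (pathCons (s, u) ⁻¹' B 0) with hf
  have hfm : Measurable f := by
    refine Finset.measurable_sum _ fun q _ => Measurable.const_mul ?_ _
    have hset : MeasurableSet {p : ℝ≥0∞ × (ℕ → S × ℝ≥0∞) | pathCons (s, p.1) p.2 ∈ B 0} :=
      (measurable_pathCons.comp ((measurable_const.prodMk measurable_fst).prodMk measurable_snd))
        (hmeas 0)
    exact measurable_measure_prodMk_left hset
  have hsplit : ∀ u, ∑ q, 𝒞.Δ s q * 𝒞.pathMeasureFrom q (pathCons (s, u) ⁻¹' B t) =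
      (Set.Ioi (t : ℝ≥0∞)).indicator (fun u => f (u - t)) u + (Set.Iic (t : ℝ≥0∞)).indicator
        (fun u => ∑ q, 𝒞.Δ s q * 𝒞.pathMeasureFrom q (B (t - u.toNNReal))) u := by
    intro u
    rcases lt_or_ge (t : ℝ≥0∞) u with h | h
    · rw [Set.indicator_of_mem (Set.mem_Ioi.2 h),
        Set.indicator_of_notMem (fun h' => h.not_ge (Set.mem_Iic.1 h')), add_zero, hf]
      have : pathCons (s, u) ⁻¹' B t = pathCons (s, u - t) ⁻¹' B 0 :=
        Set.ext fun ω => hB.mem_of_lt h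
      simp only [this]
    · rw [Set.indicator_of_mem (Set.mem_Iic.2 h),
        Set.indicator_of_notMem (fun h' => h.not_gt (Set.mem_Ioi.1 h')), zero_add]
      have : pathCons (s, u) ⁻¹' B t = B (t - u.toNNReal) := Set.ext fun ω => hB.mem_of_le h
      simp only [this]
  have hpos : ∫⁻ u, (Set.Ioi 0).indicator f u ∂𝒞.residenceLaw s = ∫⁻ u, f u ∂𝒞.residenceLaw s := by
    refine lintegral_congr_ae ?_
    filter_upwards [𝒞.ae_residenceLaw_ne_zero s] with u hu
    rw [Set.indicator_of_mem (Set.mem_Ioi.2 (pos_iff_ne_zero.2 hu))]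
  rw [pathMeasureFrom_apply 𝒞 s (hmeas t)]
  simp only [hsplit]
  have hft : Measurable fun u : ℝ≥0∞ => f (u - t) := hfm.comp (measurable_id.sub_const _)
  rw [lintegral_add_left (hft.indicator measurableSet_Ioi),
    𝒞.lintegral_residenceLaw_Ioi s t hfm, hpos, pathMeasureFrom_apply 𝒞 s (hmeas 0)]

/-- The Markov property: the state at time `t` has the transient distribution, and the future from
time `t` on is that of the chain started there. Both sides satisfy the same renewal equation. -/
theorem pathMeasureFrom_eq_sum_transient [DecidableEq S] {B : ℝ≥0 → Set (ℕ → S × ℝ≥0∞)}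
    (hB : IsFutureEvent B) (s : S) (t : ℝ≥0) :
    𝒞.pathMeasureFrom s (B t) = ∑ r, 𝒞.transient s t r * 𝒞.pathMeasureFrom r (B 0) := by
  have hF := fun s t => 𝒞.pathMeasureFrom_renewal hB s t
  have hG : ∀ s (t : ℝ≥0), ∑ r, 𝒞.transient s t r * 𝒞.pathMeasureFrom r (B 0) =
      ENNReal.ofReal (Real.exp (-(𝒞.E s * t))) * 𝒞.pathMeasureFrom s (B 0) +
      ∫⁻ u, (Set.Iic (t : ℝ≥0∞)).indicator (fun u => ∑ q, 𝒞.Δ s q *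
        ∑ r, 𝒞.transient q (t - u.toNNReal) r * 𝒞.pathMeasureFrom r (B 0)) u
          ∂𝒞.residenceLaw s := by
    intro s t
    have hm : ∀ r, Measurable ((Set.Iic (t : ℝ≥0∞)).indicator
        (fun u => ∑ q, 𝒞.Δ s q * 𝒞.transient q (t - u.toNNReal) r)) := fun r =>
      (Finset.measurable_sum _ fun q _ =>
        (𝒞.measurable_transient_sub q r t).const_mul _).indicator measurableSet_Iic
    have hi : ∀ u, (Set.Iic (t : ℝ≥0∞)).indicator (fun u => ∑ q, 𝒞.Δ s q *
        ∑ r, 𝒞.transient q (t - u.toNNReal) r * 𝒞.pathMeasureFrom r (B 0)) u =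
        ∑ r, (Set.Iic (t : ℝ≥0∞)).indicator
          (fun u => ∑ q, 𝒞.Δ s q * 𝒞.transient q (t - u.toNNReal) r) u *
            𝒞.pathMeasureFrom r (B 0) := by
      intro u
      by_cases hu : u ∈ Set.Iic (t : ℝ≥0∞)
      · simp only [Set.indicator_of_mem hu, Finset.mul_sum, Finset.sum_mul, mul_assoc]
        exact Finset.sum_comm
      · simp [Set.indicator_of_notMem hu]
    simp only [hi]
    rw [lintegral_finsetSum _ fun r _ => (hm r).mul_const _]
    simp only [fun r => lintegral_mul_const (𝒞.pathMeasureFrom r (B 0)) (hm r)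
      (μ := 𝒞.residenceLaw s)]
    conv_lhs => enter [2, r]; rw [𝒞.transient_renewal s r t]
    simp [add_mul, Finset.sum_add_distrib]
  have hG1 : ∀ s (t : ℝ≥0), ∑ r, 𝒞.transient s t r * 𝒞.pathMeasureFrom r (B 0) ≤ 1 := by
    intro s t
    refine (Finset.sum_le_sum fun r _ => mul_le_mul_right prob_le_one _).trans ?_
    simpa using (PMF.sum_mul_add_const (𝒞.transient s t) 0 1).le
  exact le_antisymm
    (𝒞.renewal_le _ (fun s t => 𝒞.pathMeasureFrom s (B t)) _ (fun _ _ => prob_le_one) hF hG s t)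
    (𝒞.renewal_le _ _ (fun s t => 𝒞.pathMeasureFrom s (B t)) hG1 hG hF s t)

/-- The chain is in its starting state at time `0`. -/
theorem ae_inStateAt_zero (s : S) :
    ∀ᵐ π ∂𝒞.pathMeasureFrom s, ∀ r, InStateAt π 0 r ↔ s = r := by
  have h1 : 𝒞.pathMeasureFrom s {π | InStateAt π 0 s}ᶜ = 0 := by
    rw [pathMeasureFrom_apply 𝒞 s (measurableSet_inStateAt_right 0 s).compl]
    refine (lintegral_congr_ae ?_).trans lintegral_zero
    filter_upwards [𝒞.ae_residenceLaw_ne_zero s] with u hu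
    have : pathCons (s, u) ⁻¹' {π | InStateAt π 0 s}ᶜ = ∅ := by
      refine Set.eq_empty_of_forall_notMem fun ω hω => hω ?_
      exact (inStateAt_pathCons_of_lt (pos_iff_ne_zero.2 hu)).2 rfl
    simp [this]
  have h2 : ∀ᵐ π ∂𝒞.pathMeasureFrom s, InStateAt π 0 s := h1
  filter_upwards [h2] with π hπ r
  exact ⟨inStateAt_unique hπ, fun h => h ▸ hπ⟩

end CTMC

/-! ### The probability of the evidence in the Markov chain -/

section EvidenceProbability

variable {S C : Type*} {n : ℕ}

/-- The event that, with `tᵢ` moved to time `t`, the observations `i, …, d` of `ρ` are made and the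
last one is made in the state `s`. -/
def suffixEvent (𝒞 : CTMC S C) (ρ : Evidence C (n + 1)) (s : S) (i : Fin (n + 1)) (t : ℝ≥0) :
    Set (ℕ → S × ℝ≥0∞) :=
  {π | (∀ j, i ≤ j → ∃ r, InStateAt π (t + (ρ.time j - ρ.time i)) r ∧ 𝒞.L r = ρ.label j) ∧
    InStateAt π (t + (ρ.time (Fin.last n) - ρ.time i)) s}

variable [Fintype S] [MeasurableSpace S] [DiscreteMeasurableSpace S]
  (𝒞 : CTMC S C) (ρ : Evidence C (n + 1))

theorem isFutureEvent_suffixEvent (s : S) (i : Fin (n + 1)) :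
    IsFutureEvent (suffixEvent 𝒞 ρ s i) where
  measurableSet := by
    have : {p : ℝ≥0 × (ℕ → S × ℝ≥0∞) | p.2 ∈ suffixEvent 𝒞 ρ s i p.1} =
        (⋂ j, ⋂ _ : i ≤ j, ⋃ r, ⋃ _ : 𝒞.L r = ρ.label j,
          {p | InStateAt p.2 (p.1 + (ρ.time j - ρ.time i)) r}) ∩
        {p | InStateAt p.2 (p.1 + (ρ.time (Fin.last n) - ρ.time i)) s} := by
      ext p
      simp [suffixEvent, and_comm]
    rw [this]
    refine MeasurableSet.inter (.iInter fun j => .iInter fun _ => ?_) (measurableSet_inStateAt _ _)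
    exact .iUnion fun r => .iUnion fun _ => measurableSet_inStateAt _ _
  mem_of_lt h := by
    change (_ ∧ _) ↔ (_ ∧ _)
    simp only [inStateAt_pathCons_add_of_lt h]
  mem_of_le h := by
    change (_ ∧ _) ↔ (_ ∧ _)
    simp only [inStateAt_pathCons_add_of_le h]

theorem measurableSet_pathConsistent : MeasurableSet {π | PathConsistent 𝒞 ρ π} := by
  have : {π | PathConsistent 𝒞 ρ π} = ⋂ i, ⋃ s, ⋃ _ : 𝒞.L s = ρ.label i,
      {π : ℕ → S × ℝ≥0∞ | InStateAt π (ρ.time i) s} := by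
    ext π
    simp [PathConsistent, and_comm]
  rw [this]
  exact .iInter fun i => .iUnion fun s => .iUnion fun _ => measurableSet_inStateAt_right _ _

variable [DecidableEq S]

/-- The backward recursion computes the probabilities of the suffix events, by the Markov property
between consecutive observation times. -/
theorem pathMeasureFrom_suffixEvent_zero (s : S) (i : Fin (n + 1)) (s' : S) :
    𝒞.pathMeasureFrom s' (suffixEvent 𝒞 ρ s i 0) =
      evidenceValue 𝒞 ρ (Pi.single s 1) i s' := by
  classical
  induction i using Fin.reverseInduction generalizing s' with
  | last =>
    have hae : suffixEvent 𝒞 ρ s (Fin.last n) 0 =ᵐ[𝒞.pathMeasureFrom s']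
        {_π | 𝒞.L s' = ρ.label (Fin.last n) ∧ s' = s} := by
      filter_upwards [𝒞.ae_inStateAt_zero s'] with π hπ
      refine propext (?_ : (_ ∧ _) ↔ (_ ∧ _))
      simp [hπ, Fin.last_le_iff]
    rw [measure_congr hae, evidenceValue_last]
    by_cases hL : 𝒞.L s' = ρ.label (Fin.last n)
    · by_cases hs : s' = s
      · subst hs; simp [hL]
      · simp [hs]
    · simp [hL]
  | cast i ih =>
    rw [evidenceValue_castSucc]
    have hae : suffixEvent 𝒞 ρ s i.castSucc 0 =ᵐ[𝒞.pathMeasureFrom s']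
        {π | 𝒞.L s' = ρ.label i.castSucc ∧
          π ∈ suffixEvent 𝒞 ρ s i.succ (ρ.time i.succ - ρ.time i.castSucc)} := by
      filter_upwards [𝒞.ae_inStateAt_zero s'] with π hπ
      refine propext (?_ : (_ ∧ _) ↔ (_ ∧ (_ ∧ _)))
      -- the offsets from `tᵢ` and from `tᵢ₊₁` refer to the same observation times
      have htime : ∀ j, i.succ ≤ j → ρ.time i.succ - ρ.time i.castSucc +
          (ρ.time j - ρ.time i.succ) = 0 + (ρ.time j - ρ.time i.castSucc) := fun j hj => by
        rw [zero_add, add_comm]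
        exact tsub_add_tsub_cancel (ρ.time_strictMono.monotone hj)
          (ρ.time_strictMono i.castSucc_lt_succ).le
      rw [htime _ (Fin.le_last _), ← and_assoc]
      refine and_congr_left' ⟨fun h => ⟨?_, fun j hj => ?_⟩, fun h j hj => ?_⟩
      · simpa [hπ] using h i.castSucc le_rfl
      · rw [htime j hj]
        exact h j (i.castSucc_lt_succ.le.trans hj)
      · rcases hj.eq_or_lt with rfl | hj
        · simpa [hπ] using h.1
        · rw [← htime j (Fin.castSucc_lt_iff_succ_le.1 hj)]
          exact h.2 j (Fin.castSucc_lt_iff_succ_le.1 hj)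
    rw [measure_congr hae]
    by_cases hL : 𝒞.L s' = ρ.label i.castSucc
    · rw [if_pos hL]
      simp only [hL, true_and]
      refine (𝒞.pathMeasureFrom_eq_sum_transient (isFutureEvent_suffixEvent 𝒞 ρ s i.succ) s'
        _).trans ?_
      simp only [ih]
    · simp [hL]

theorem pathMeasure_pathConsistent_inter (s : S) :
    𝒞.pathMeasure ({π | PathConsistent 𝒞 ρ π} ∩ {π | InStateAt π (ρ.time (Fin.last n)) s}) =
      evidenceMass 𝒞 ρ (Pi.single s 1) := by
  have h : ({π | PathConsistent 𝒞 ρ π} ∩ {π | InStateAt π (ρ.time (Fin.last n)) s} :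
      Set (ℕ → S × ℝ≥0∞)) = suffixEvent 𝒞 ρ s 0 (ρ.time 0) := by
    have htime : ∀ j, ρ.time 0 + (ρ.time j - ρ.time 0) = ρ.time j := fun j =>
      add_tsub_cancel_of_le (ρ.time_strictMono.monotone (Fin.zero_le j))
    ext π
    change (PathConsistent 𝒞 ρ π ∧ _) ↔ (_ ∧ _)
    simp [htime, PathConsistent]
  have h2 := 𝒞.pathMeasureFrom_eq_sum_transient (isFutureEvent_suffixEvent 𝒞 ρ s 0) 𝒞.init
    (ρ.time 0)
  simp only [pathMeasureFrom_suffixEvent_zero] at h2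
  rw [h]
  exact h2

theorem pathMeasure_pathConsistent :
    𝒞.pathMeasure {π | PathConsistent 𝒞 ρ π} = evidenceMass 𝒞 ρ 1 := by
  have h : {π | PathConsistent 𝒞 ρ π} =
      ⋃ s, {π | PathConsistent 𝒞 ρ π} ∩ {π | InStateAt π (ρ.time (Fin.last n)) s} := by
    rw [← Set.inter_iUnion, eq_comm, Set.inter_eq_left]
    intro π hπ
    obtain ⟨s, hs, -⟩ := hπ (Fin.last n)
    exact Set.mem_iUnion.2 ⟨s, hs⟩
  rw [h, measure_iUnion, tsum_fintype, evidenceMass_one]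
  · exact Finset.sum_congr rfl fun s _ => pathMeasure_pathConsistent_inter 𝒞 ρ s
  · exact fun s r hsr => Set.disjoint_left.2 fun π hs hr => hsr (inStateAt_unique hs.2 hr.2)
  · exact fun s => (measurableSet_pathConsistent 𝒞 ρ).inter (measurableSet_inStateAt_right _ s)

theorem cond_pathConsistent (s : S) :
    ProbabilityTheory.cond 𝒞.pathMeasure {π | PathConsistent 𝒞 ρ π}
      {π | InStateAt π (ρ.time (Fin.last n)) s} =
      (evidenceMass 𝒞 ρ 1)⁻¹ * evidenceMass 𝒞 ρ (Pi.single s 1) := by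
  rw [cond_apply (measurableSet_pathConsistent 𝒞 ρ), pathMeasure_pathConsistent,
    pathMeasure_pathConsistent_inter]

end EvidenceProbability

/-! ### Consistent schedulers -/

section Schedulers

variable {S C : Type*} {n : ℕ}

theorem Evidence.graph_edge_unique (ρ : Evidence C (n + 1)) {t t' t'' : ℝ≥0∞}
    (h' : ρ.graph.edge t t') (h'' : ρ.graph.edge t t'') : t' = t'' := by
  have hpos : ∀ i, (0 : ℝ≥0∞) ≠ ρ.time i := fun i =>
    (ENNReal.coe_pos.2 (ρ.time_pos i)).ne
  have hinj : ∀ {i j}, (ρ.time i : ℝ≥0∞) = ρ.time j → i = j := fun h =>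
    ρ.time_strictMono.injective (ENNReal.coe_inj.1 h)
  rcases h' with ⟨rfl, rfl⟩ | ⟨i, rfl, rfl⟩ | ⟨rfl, rfl⟩ <;>
    rcases h'' with ⟨h, rfl⟩ | ⟨j, h, rfl⟩ | ⟨h, rfl⟩
  · rfl
  · exact absurd h (hpos _)
  · exact absurd h (hpos _)
  · exact absurd h.symm (hpos _)
  · rw [Fin.castSucc_injective n (hinj h)]
  · exact absurd (hinj h) (Fin.castSucc_lt_last i).ne
  · exact absurd h.symm (hpos _)
  · exact absurd (hinj h).symm (Fin.castSucc_lt_last j).ne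
  · rfl

variable [Fintype S] [DecidableEq S] {𝒞 : CTMC S C} {Ω : ImpreciseEvidence C (n + 1)}
  {ρ : Evidence C (n + 1)}

theorem schedulerConsistent_of_edge {σ : (unfoldedMDP 𝒞 Ω.graph).Scheduler}
    (h : ∀ (q : UnfoldedState S Ω.graph) (t' : Ω.graph.nodes), ρ.graph.edge q.time t' →
      (unfoldedMDP 𝒞 Ω.graph).Chooses σ q t') : SchedulerConsistent σ ρ :=
  fun q t' => ⟨fun h1 h2 => h q t' (.inl ⟨h1, h2⟩),
    fun i h1 h2 => h q t' (.inr (.inl ⟨i, h1, h2⟩)), fun h1 h2 => h q t' (.inr (.inr ⟨h1, h2⟩))⟩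

/-- A scheduler that follows the edges of `ρ` where there are any is well defined, since a node has
at most one successor along `ρ`. -/
theorem exists_schedulerConsistent (hρ : ρ ∈ Ω.instances) :
    ∃ σ : (unfoldedMDP 𝒞 Ω.graph).Scheduler, SchedulerConsistent σ ρ := by
  have hσ : ∀ q : {q // ((unfoldedMDP 𝒞 Ω.graph).enabled q).Nonempty},
      ∃ a : (unfoldedMDP 𝒞 Ω.graph).enabled q.1, ∀ t' : Ω.graph.nodes,
        ρ.graph.edge q.1.time t' → (a : Ω.graph.nodes) = t' := by
    rintro ⟨q, hq⟩
    by_cases h : ∃ t' : Ω.graph.nodes, ρ.graph.edge q.time t'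
    · obtain ⟨t', ht'⟩ := h
      exact ⟨⟨t', ρ, hρ, ht'⟩, fun t'' ht'' => Subtype.ext (ρ.graph_edge_unique ht' ht'')⟩
    · exact ⟨⟨hq.some, hq.some_mem⟩, fun t' ht' => absurd ⟨t', ht'⟩ h⟩
  choose σ hσ using hσ
  exact ⟨σ, schedulerConsistent_of_edge fun q t' h => ⟨⟨t', ρ, hρ, h⟩, hσ _ t' h⟩⟩

variable [MeasurableSpace S] [DiscreteMeasurableSpace S]

theorem weightedReach_eq_of_consistent (w : S → ℝ≥0) (hρ : ρ ∈ Ω.instances)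
    {σ : (unfoldedMDP 𝒞 Ω.graph).Scheduler} (hσ : SchedulerConsistent σ ρ) :
    weightedReach 𝒞 w Ω σ = ∑ s, ProbabilityTheory.cond 𝒞.pathMeasure {π | PathConsistent 𝒞 ρ π}
      {π | InStateAt π (ρ.time (Fin.last n)) s} * (w s : ℝ≥0∞) :=
  Finset.sum_congr rfl fun s _ => by rw [reach_terminal hρ hσ, cond_pathConsistent]

theorem weightedCondReach_eq_iSup (w : S → ℝ≥0) :
    weightedCondReach 𝒞 w Ω = ⨆ σ ∈ consistentSchedulers 𝒞 Ω, weightedReach 𝒞 w Ω σ := by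
  refine le_antisymm (iSup₂_le fun ρ hρ => ?_) (iSup₂_le fun σ hσ => ?_)
  · obtain ⟨σ, hσ⟩ := exists_schedulerConsistent (𝒞 := 𝒞) hρ
    rw [← weightedReach_eq_of_consistent w hρ hσ]
    exact le_iSup₂ (f := fun σ (_ : σ ∈ consistentSchedulers 𝒞 Ω) => weightedReach 𝒞 w Ω σ)
      σ ⟨ρ, hρ, hσ⟩
  · obtain ⟨ρ, hρ, hσ⟩ := hσ
    rw [weightedReach_eq_of_consistent w hρ hσ]
    exact le_iSup₂ (f := fun (ρ : Evidence C (n + 1)) (_ : ρ ∈ Ω.instances) =>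
      ∑ s, ProbabilityTheory.cond 𝒞.pathMeasure {π | PathConsistent 𝒞 ρ π}
        {π | InStateAt π (ρ.time (Fin.last n)) s} * (w s : ℝ≥0∞)) ρ hρ

end Schedulers

section Precise

variable {S C : Type*} {n : ℕ} {Ω : ImpreciseEvidence C (n + 1)} {ρ : Evidence C (n + 1)}

theorem ImpreciseEvidence.instances_eq_singleton (h : ∀ i, ∃ t, Ω.timing i = {t})
    (hρ : ρ ∈ Ω.instances) : Ω.instances = {ρ} := by
  refine Set.eq_singleton_iff_unique_mem.2 ⟨hρ, fun ρ' hρ' => ?_⟩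
  have htime : ρ'.time = ρ.time := by
    funext i
    obtain ⟨t, ht⟩ := h i
    have h1 := hρ.1 i
    have h2 := hρ'.1 i
    rw [ht] at h1 h2
    exact h2.trans h1.symm
  have hlabel : ρ'.label = ρ.label := hρ'.2.trans hρ.2.symm
  cases ρ
  cases ρ'
  subst htime hlabel
  rfl

theorem finite_unfoldedState [Finite S] (h : Ω.instances = {ρ}) :
    Finite (UnfoldedState S Ω.graph) := by
  have hn : Ω.graph.nodes.Finite := by
    change (⋃ ρ ∈ Ω.instances, ρ.graph.nodes).Finite
    rw [h, Set.biUnion_singleton]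
    exact (Set.toFinite {0, ∞}).union (Set.finite_range _)
  have := hn.to_subtype
  exact Finite.of_injective (fun q : UnfoldedState S Ω.graph => (q.state, q.time))
    fun _ _ hq => UnfoldedState.ext (congrArg Prod.fst hq) (congrArg Prod.snd hq)

theorem scheduler_subsingleton [Fintype S] [DecidableEq S] {𝒞 : CTMC S C}
    (h : Ω.instances = {ρ}) : Subsingleton (unfoldedMDP 𝒞 Ω.graph).Scheduler := by
  refine ⟨fun σ σ' => funext fun q => Subtype.ext (Subtype.ext ?_)⟩
  have hedge : ∀ a : (unfoldedMDP 𝒞 Ω.graph).enabled q.1, ρ.graph.edge q.1.time (a : Ω.graph.nodes) := by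
    rintro ⟨t', ρ', hρ', ht'⟩
    rw [h] at hρ'
    obtain rfl : ρ' = ρ := hρ'
    exact ht'
  exact ρ.graph_edge_unique (hedge (σ q)) (hedge (σ' q))

end Precise

theorem theorem2 {S C : Type*} [Fintype S] [DecidableEq S] [MeasurableSpace S]
    [DiscreteMeasurableSpace S] {n : ℕ} (𝒞 : CTMC S C) (w : S → ℝ≥0)
    (Ω : ImpreciseEvidence C (n + 1)) :
    weightedCondReach 𝒞 w Ω = (⨆ σ ∈ consistentSchedulers 𝒞 Ω, weightedReach 𝒞 w Ω σ) ∧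
    ((∀ i, ∃ t, Ω.timing i = {t}) →
      Finite (UnfoldedState S Ω.graph) ∧
      ∃ σ : (unfoldedMDP 𝒞 Ω.graph).Scheduler, (∀ σ', σ' = σ) ∧
        σ ∈ consistentSchedulers 𝒞 Ω ∧
        weightedCondReach 𝒞 w Ω = weightedReach 𝒞 w Ω σ) := by
  refine ⟨weightedCondReach_eq_iSup w, fun h => ?_⟩
  obtain ⟨ρ, hρ⟩ := Ω.instances_nonempty
  have hΩ := ImpreciseEvidence.instances_eq_singleton h hρ
  have := scheduler_subsingleton (𝒞 := 𝒞) hΩ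
  obtain ⟨σ, hσ⟩ := exists_schedulerConsistent (𝒞 := 𝒞) hρ
  refine ⟨finite_unfoldedState hΩ, σ, fun σ' => Subsingleton.elim _ _, ⟨ρ, hρ, hσ⟩, ?_⟩
  rw [weightedReach_eq_of_consistent w hρ hσ, weightedCondReach, hΩ, iSup_singleton]
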